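/- **Setting.** Let $K=\mathbb C^p$, $H=K\otimes L^2(0,\infty)$ (square integrable $K$-valued functions on $(0,\infty)$), and let $\Lambda:B(K)\to B(H)$ be $(\Lambda(A)F)(x)=e^{-x}AF(x)$; write $\Lambda$ also for $\Lambda(I)$. Let $\mathfrak A(K)=\{(I-\Lambda)^{1/2}B(I-\Lambda)^{1/2}: B\in B(H)\}$. For $t>0$ let $E(t,\infty)$ be the projection of $H$ onto the functions supported in $[t,\infty)$; then $E(t,\infty)AE(t,\infty)\in\mathfrak A(K)$ for $A\in B(H)$, and for a linear map $\omega:\mathfrak A(K)\to B(K)$ put $\omega|_t(A)=\omega(E(t,\infty)AE(t,\infty))$, $A\in B(H)$. A *$q$-weight map* over $\mathbb C^p$ is a completely positive linear map $\omega:\mathfrak A(K)\to B(K)$ such that $B\mapsto (f,\omega((I-\Lambda)^{1/2}B(I-\Lambda)^{1/2})g)$ is $\sigma$-weakly continuous on $B(H)$ for all $f,g\in K$ and such that, for each $t>0$, the map $\iota+\omega|_t\Lambda$ of $B(K)$ into itself is invertible ($\iota$ the identity map) and $\pi_t^\#=(\iota+\omega|_t\Lambda)^{-1}\omega|_t$ is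 a completely positive contractive normal map of $B(H)$ into $B(K)$. It has *index zero* if its normal spine is zero, i.e. $\pi_t^\#(E(s,\infty)AE(s,\infty))\to 0$ as $t\to0+$ for all $s>0$ and $A\in B(H)$. A $q$-weight map $\eta$ with corresponding maps $\psi_t^\#$ is a *$q$-subordinate* of $\omega$, written $\omega\ge_q\eta$, if $\pi_t^\#-\psi_t^\#$ is completely positive for all $t>0$; and $\omega$ is *$q$-pure* if for any two $q$-subordinates $\eta_1,\eta_2$ of $\omega$ either $\eta_1\ge_q\eta_2$ or $\eta_2\ge_q\eta_1$. Finally, $\mathcal L\subseteq B(K)$ is a *Choi–Effros factor* if there is a completely positive contractive idempotent $L:B(K)\to B(K)$ with range $\mathcal L$ such that $\mathcal L$, with the product $A\star B=L(AB)$, the involution of $B(K)$ and the unit $L(I)$, is $*$-isomorphic to the algebra of $q\times q$ complex matrices for some $q\ge1$. **Theorem.** Let $\omega$ be a $q$-weight map over $\mathbb C^p$ of index zero, with range $\mathcal L$. The maps $\pi_t^\#\Lambda$ of $B(\mathbb C^p)$ into itself have a limit point as $t\to0+$, and every such limit point $L$ is a completely positive contractive idempotent map with range $\mathcal L$ (so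 that $\mathcal L$ is a Choi–Effros algebra with the product $A\star B=L(AB)$). Moreover: 1. For every limit point $L$ of $\pi_t^\#\Lambda$ as $t\to0+$ and every nonzero central projection $Q$ of $(\mathcal L,\star)$ (that is, $0\ne Q=Q^*\in\mathcal L$, $Q\star Q=Q$ and $Q\star A=A\star Q$ for all $A\in\mathcal L$) there is a $q$-subordinate $\eta$ of $\omega$ whose range is $Q\star\mathcal L=\{Q\star A:A\in\mathcal L\}$. 2. If $\omega$ is nonzero and $q$-pure, then $\mathcal L$ is a Choi–Effros factor; indeed, for every limit point $L$ of $\pi_t^\#\Lambda$ as $t\to0+$, the map $L$ can serve as the idempotent in the definition of a Choi–Effros factor. -/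

import Mathlib

open MeasureTheory Filter Topology
open scoped ENNReal ComplexOrder InnerProductSpace

noncomputable section

namespace QWeight

/-- The finite dimensional Hilbert space `K = ℂ^p`. -/
abbrev K (p : ℕ) : Type := EuclideanSpace ℂ (Fin p)

/-- Lebesgue measure on the half line `(0, ∞)`. -/
abbrev halfLine : Measure ℝ := volume.restrict (Set.Ioi 0)

/-- The Hilbert space `H = K ⊗ L²(0, ∞)`, realised as the space of square integrable
`K`-valued functions on `(0, ∞)`. -/
abbrev H (p : ℕ) : Type := Lp (K p) 2 halfLine

/-- `B(K) = B(ℂ^p)`. -/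
abbrev BK (p : ℕ) : Type := K p →L[ℂ] K p

/-- `B(H)`. -/
abbrev BH (p : ℕ) : Type := H p →L[ℂ] H p

/-! ### General notions for operators on Hilbert spaces -/

section General

variable {X Y : Type*}
  [NormedAddCommGroup X] [InnerProductSpace ℂ X] [CompleteSpace X]
  [NormedAddCommGroup Y] [InnerProductSpace ℂ Y] [CompleteSpace Y]

/-- The functional `A ↦ ∑ₖ (Fₖ, A Gₖ)` on `B(X)`, where `∑ ‖Fₖ‖² < ∞` and `∑ ‖Gₖ‖² < ∞`. -/
def sigmaWeakFunctional (FG : lp (fun _ : ℕ => X) 2 × lp (fun _ : ℕ => X) 2) (A : X →L[ℂ] X) : ℂ :=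
  ∑' k, ⟪FG.1 k, A (FG.2 k)⟫_ℂ

/-- The σ-weak topology on `B(X)`: the coarsest topology which makes all functionals
`A ↦ ∑ₖ (Fₖ, A Gₖ)` continuous. -/
@[reducible] def sigmaWeakTopology : TopologicalSpace (X →L[ℂ] X) :=
  ⨅ FG : lp (fun _ : ℕ => X) 2 × lp (fun _ : ℕ => X) 2,
    TopologicalSpace.induced (sigmaWeakFunctional FG) inferInstance

/-- A linear map `φ : B(X) → B(Y)` is normal if all functionals `A ↦ (f, φ(A) g)` are
σ-weakly continuous. (Only used for finite dimensional `Y`.) -/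
def IsNormalMap (φ : (X →L[ℂ] X) →ₗ[ℂ] (Y →L[ℂ] Y)) : Prop :=
  ∀ f g : Y, Continuous[sigmaWeakTopology, inferInstance] fun A => ⟪f, φ A g⟫_ℂ

/-- Complete positivity of a linear map `φ : B(X) → B(Y)`:
`∑ᵢⱼ (fᵢ, φ(Aᵢ* Aⱼ) fⱼ) ≥ 0`. -/
def IsCP (φ : (X →L[ℂ] X) →ₗ[ℂ] (Y →L[ℂ] Y)) : Prop :=
  ∀ (n : ℕ) (A : Fin n → (X →L[ℂ] X)) (f : Fin n → Y),
    0 ≤ ∑ i, ∑ j, ⟪f i, φ (star (A i) * A j) (f j)⟫_ℂ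

/-- A linear map is contractive if it does not increase the operator norm. -/
def IsContractive (φ : (X →L[ℂ] X) →ₗ[ℂ] (Y →L[ℂ] Y)) : Prop :=
  ∀ A, ‖φ A‖ ≤ ‖A‖

/-- The linear map `A ↦ S A S` on `B(X)`. -/
def sandwich (S : X →L[ℂ] X) : (X →L[ℂ] X) →ₗ[ℂ] (X →L[ℂ] X) where
  toFun A := S * A * S
  map_add' A B := by rw [mul_add, add_mul]
  map_smul' c A := by simp

end General

/-! ### Multiplication operators on `H` -/

/-- The operator of multiplication by the essentially bounded scalar function `g` on `H`. -/
def mulOp (p : ℕ) (g : ℝ → ℂ) (hg : MemLp g ∞ halfLine) : BH p :=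
  (ContinuousLinearMap.lsmul ℂ ℂ : ℂ →L[ℂ] K p →L[ℂ] K p).holderL halfLine ∞ 2 2 (hg.toLp g)

theorem mulOp_ae (p : ℕ) (g : ℝ → ℂ) (hg : MemLp g ∞ halfLine) (F : H p) :
    mulOp p g hg F =ᵐ[halfLine] fun x => g x • F x := by
  have h1 := ContinuousLinearMap.coeFn_holder (r := 2)
    (B := (ContinuousLinearMap.lsmul ℂ ℂ : ℂ →L[ℂ] K p →L[ℂ] K p)) (f := hg.toLp g) (g := F)
  filter_upwards [h1, hg.coeFn_toLp] with x hx hx2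
  have : (mulOp p g hg F) x = _ := hx
  rw [this, hx2]
  rfl

theorem mulOp_mul (p : ℕ) (g h k : ℝ → ℂ) (hg : MemLp g ∞ halfLine) (hh : MemLp h ∞ halfLine)
    (hk : MemLp k ∞ halfLine) (e : ∀ x, 0 < x → g x * h x = k x) :
    mulOp p g hg * mulOp p h hh = mulOp p k hk := by
  ext1 F
  apply Lp.ext
  have h0 : ∀ᵐ x ∂halfLine, x ∈ Set.Ioi (0 : ℝ) := ae_restrict_mem measurableSet_Ioi
  filter_upwards [mulOp_ae p g hg (mulOp p h hh F), mulOp_ae p h hh F, mulOp_ae p k hk F, h0]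
    with x h1 h2 h3 h4
  change (mulOp p g hg (mulOp p h hh F)) x = _
  rw [h1, h2, h3, smul_smul, e x h4]

theorem memLp_halfLine {g : ℝ → ℂ} (hm : Measurable g) (C : ℝ)
    (hC : ∀ x, 0 < x → ‖g x‖ ≤ C) : MemLp g ∞ halfLine :=
  MeasureTheory.memLp_top_of_bound hm.aestronglyMeasurable C
    ((ae_restrict_mem measurableSet_Ioi).mono fun x hx => hC x hx)

/-- The function `x ↦ e^{-x}`. -/
def expFun (x : ℝ) : ℂ := (Real.exp (-x) : ℝ)

/-- The function `x ↦ (1 - e^{-x})^{1/2}`. -/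
def rootFun (x : ℝ) : ℂ := (√(1 - Real.exp (-x)) : ℝ)

/-- The indicator function of `[t, ∞)`. -/
def cutFun (t x : ℝ) : ℂ := (Set.Ici t).indicator 1 x

/-- The function equal to `(1 - e^{-x})^{-1/2}` on `[t, ∞)` and to `0` elsewhere. -/
def invRootFun (t x : ℝ) : ℂ := (Set.Ici t).indicator (fun x => (rootFun x)⁻¹) x

theorem memLp_expFun : MemLp expFun ∞ halfLine := by
  refine memLp_halfLine (by unfold expFun; fun_prop) 1 fun x hx => ?_
  rw [expFun, Complex.norm_real, Real.norm_of_nonneg (Real.exp_pos _).le]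
  exact Real.exp_le_one_iff.2 (by linarith)

theorem measurable_rootFun : Measurable rootFun := by unfold rootFun; fun_prop

theorem memLp_rootFun : MemLp rootFun ∞ halfLine := by
  refine memLp_halfLine measurable_rootFun 1 fun x hx => ?_
  rw [rootFun, Complex.norm_real, Real.norm_of_nonneg (Real.sqrt_nonneg _)]
  exact Real.sqrt_le_one.2 (by linarith [Real.exp_pos (-x)])

theorem memLp_cutFun (t : ℝ) : MemLp (cutFun t) ∞ halfLine := by
  refine memLp_halfLine (measurable_one.indicator measurableSet_Ici) 1 fun x hx => ?_
  by_cases h : x ∈ Set.Ici t <;> simp [cutFun, h]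

theorem memLp_invRootFun {t : ℝ} (ht : 0 < t) : MemLp (invRootFun t) ∞ halfLine := by
  refine memLp_halfLine (measurable_rootFun.inv.indicator measurableSet_Ici)
    (√(1 - Real.exp (-t)))⁻¹ fun x hx => ?_
  have h1 : 0 < 1 - Real.exp (-t) := by
    have := Real.exp_lt_one_iff.2 (neg_lt_zero.2 ht)
    linarith
  by_cases h : x ∈ Set.Ici t
  · have h2 : Real.exp (-x) ≤ Real.exp (-t) := Real.exp_le_exp.2 (neg_le_neg h)
    rw [invRootFun, Set.indicator_of_mem h, norm_inv, rootFun, Complex.norm_real,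
      Real.norm_of_nonneg (Real.sqrt_nonneg _)]
    exact inv_anti₀ (Real.sqrt_pos.2 h1) (Real.sqrt_le_sqrt (by linarith))
  · rw [invRootFun, Set.indicator_of_notMem h, norm_zero]
    positivity

/-- The mapping `Λ : B(K) → B(H)`, `(Λ(A)F)(x) = e^{-x} A F(x)`. -/
def Lam (p : ℕ) : BK p →ₗ[ℂ] BH p where
  toFun A := mulOp p expFun memLp_expFun * A.compLpL 2 halfLine
  map_add' A B := by rw [ContinuousLinearMap.add_compLpL, mul_add]
  map_smul' c A := by
    rw [ContinuousLinearMap.smul_compLpL, mul_smul_comm, RingHom.id_apply]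

/-- The operator `(I - Λ(I))^{1/2}`: multiplication by `(1 - e^{-x})^{1/2}`. -/
def rootOp (p : ℕ) : BH p := mulOp p rootFun memLp_rootFun

/-- The projection `E(t, ∞)` of `H` onto the functions supported in `[t, ∞)`. -/
def cutOp (p : ℕ) (t : ℝ) : BH p := mulOp p (cutFun t) (memLp_cutFun t)

/-- The map `A ↦ E(t, ∞) A E(t, ∞)` on `B(H)`. -/
def cutMap (p : ℕ) (t : ℝ) : BH p →ₗ[ℂ] BH p := sandwich (cutOp p t)

/-- `𝔄(K)`: the operators `(I - Λ)^{1/2} B (I - Λ)^{1/2}` with `B ∈ B(H)`. -/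
def bdryAlg (p : ℕ) : Submodule ℂ (BH p) := LinearMap.range (sandwich (rootOp p))

/-- The map `B ↦ (I - Λ)^{1/2} B (I - Λ)^{1/2}` from `B(H)` to `𝔄(K)`. -/
def toBdryAlg (p : ℕ) : BH p →ₗ[ℂ] bdryAlg p := (sandwich (rootOp p)).rangeRestrict

theorem cutMap_mem {p : ℕ} {t : ℝ} (ht : 0 < t) (A : BH p) : cutMap p t A ∈ bdryAlg p := by
  have e : ∀ x, 0 < x → rootFun x * invRootFun t x = cutFun t x := by
    intro x hx
    by_cases h : x ∈ Set.Ici t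
    · have h1 : rootFun x ≠ 0 := by
        have := Real.exp_lt_one_iff.2 (neg_lt_zero.2 hx)
        have h2 : 0 < √(1 - Real.exp (-x)) := Real.sqrt_pos.2 (by linarith)
        rw [rootFun]
        exact_mod_cast h2.ne'
      rw [invRootFun, cutFun, Set.indicator_of_mem h, Set.indicator_of_mem h,
        mul_inv_cancel₀ h1, Pi.one_apply]
    · rw [invRootFun, cutFun, Set.indicator_of_notMem h, Set.indicator_of_notMem h, mul_zero]
  have e1 := mulOp_mul p _ _ _ memLp_rootFun (memLp_invRootFun ht) (memLp_cutFun t) e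
  have e2 := mulOp_mul p _ _ _ (memLp_invRootFun ht) memLp_rootFun (memLp_cutFun t)
    fun x hx => by rw [mul_comm, e x hx]
  refine ⟨mulOp p _ (memLp_invRootFun ht) * A * mulOp p _ (memLp_invRootFun ht), ?_⟩
  change rootOp p * (_ * A * _) * rootOp p = cutOp p t * A * cutOp p t
  rw [cutOp, rootOp]
  nth_rw 1 [← e1]
  rw [← e2]
  simp only [mul_assoc]

/-! ### Boundary weight maps and `q`-weight maps -/

/-- The linear maps `𝔄(K) → B(K)`. -/
abbrev WeightMap (p : ℕ) : Type := bdryAlg p →ₗ[ℂ] BK p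

/-- `ω ∈ B(K) ⊗ 𝔄(K)_*`: for all `f, g` the functional `B ↦ (f, ω((I-Λ)^{1/2} B (I-Λ)^{1/2}) g)`
is σ-weakly continuous on `B(H)`. -/
def IsBoundaryWeightMap {p : ℕ} (ω : WeightMap p) : Prop := IsNormalMap (ω ∘ₗ toBdryAlg p)

/-- Complete positivity of `ω : 𝔄(K) → B(K)`. The `Aᵢ` range over all of `B(H)` with
`Aᵢ* Aⱼ ∈ 𝔄(K)`, so that the matrices `(Aᵢ* Aⱼ)` generate all positive matrices
over `𝔄(K)`. -/
def IsCPWeightMap {p : ℕ} (ω : WeightMap p) : Prop :=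
  ∀ (n : ℕ) (A : Fin n → BH p) (hA : ∀ i j, star (A i) * A j ∈ bdryAlg p) (f : Fin n → K p),
    0 ≤ ∑ i, ∑ j, ⟪f i, ω ⟨star (A i) * A j, hA i j⟩ (f j)⟫_ℂ

/-- The cut off `ω|_t : B(H) → B(K)`, `ω|_t(A) = ω(E(t,∞) A E(t,∞))`, for `t > 0`
(and `0` for `t ≤ 0`, a case which is never used). -/
def cutoff {p : ℕ} (ω : WeightMap p) (t : ℝ) : BH p →ₗ[ℂ] BK p :=
  open Classical in
  if ht : 0 < t then ω ∘ₗ (cutMap p t).codRestrict (bdryAlg p) (cutMap_mem ht) else 0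

/-- The map `ι + ω|_t Λ` of `B(K)` into itself. -/
def iotaAdd {p : ℕ} (ω : WeightMap p) (t : ℝ) : Module.End ℂ (BK p) :=
  LinearMap.id + cutoff ω t ∘ₗ Lam p

/-- The generalized boundary representation `π_t^# = (ι + ω|_t Λ)⁻¹ ω|_t`
(meaningful when `ι + ω|_t Λ` is invertible). -/
def bdryRep {p : ℕ} (ω : WeightMap p) (t : ℝ) : BH p →ₗ[ℂ] BK p :=
  Ring.inverse (iotaAdd ω t) ∘ₗ cutoff ω t

/-- `q`-weight maps over `ℂ^p`. -/
structure IsQWeightMap {p : ℕ} (ω : WeightMap p) : Prop where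
  boundaryWeight : IsBoundaryWeightMap ω
  cp : IsCPWeightMap ω
  invertible : ∀ t, 0 < t → IsUnit (iotaAdd ω t)
  rep_cp : ∀ t, 0 < t → IsCP (bdryRep ω t)
  rep_contractive : ∀ t, 0 < t → IsContractive (bdryRep ω t)
  rep_normal : ∀ t, 0 < t → IsNormalMap (bdryRep ω t)

/-- `η` is a `q`-subordinate of `ω`, written `ω ≥_q η`. -/
structure IsQSubordinate {p : ℕ} (ω η : WeightMap p) : Prop where
  left : IsQWeightMap ω
  right : IsQWeightMap η
  le : ∀ t, 0 < t → IsCP (bdryRep ω t - bdryRep η t)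

/-- A `q`-weight map is `q`-pure if its `q`-subordinates are totally ordered. -/
structure IsQPure {p : ℕ} (ω : WeightMap p) : Prop where
  isQWeightMap : IsQWeightMap ω
  total : ∀ η₁ η₂, IsQSubordinate ω η₁ → IsQSubordinate ω η₂ →
    IsQSubordinate η₁ η₂ ∨ IsQSubordinate η₂ η₁

/-- `π₀` is the normal spine of `ω`: the normal completely positive map with
`π_t^#|_s(A) → π₀|_s(A)` as `t → 0+` for every `s > 0` and `A ∈ B(H)`, where `π|_s` is
`A ↦ π(E(s,∞) A E(s,∞))`. -/
structure IsNormalSpine {p : ℕ} (ω : WeightMap p) (π₀ : BH p →ₗ[ℂ] BK p) : Prop where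
  cp : IsCP π₀
  normal : IsNormalMap π₀
  tendsto : ∀ s, 0 < s → ∀ A : BH p,
    Tendsto (fun t => bdryRep ω t (cutMap p s A)) (𝓝[>] 0) (𝓝 (π₀ (cutMap p s A)))

/-- `ω` is of index zero if its normal spine is zero. -/
def IsIndexZero {p : ℕ} (ω : WeightMap p) : Prop := IsNormalSpine ω 0

/-- `L` is a limit point of the maps `π_t^# Λ : B(K) → B(K)` as `t → 0+`. (The topology is that of
pointwise convergence, the usual one as `B(K)` is finite dimensional.) -/
def IsLimitPoint {p : ℕ} (ω : WeightMap p) (L : BK p →ₗ[ℂ] BK p) : Prop :=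
  MapClusterPt (fun A => L A) (𝓝[>] 0) (fun (t : ℝ) (A : BK p) => bdryRep ω t (Lam p A))

/-! ### Choi–Effros algebras -/

/-- `L` is a completely positive contractive idempotent map of `B(K)` with range `𝓛`. -/
structure IsCPIdempotentOnto {p : ℕ} (L : BK p →ₗ[ℂ] BK p) (𝓛 : Submodule ℂ (BK p)) : Prop where
  cp : IsCP L
  contractive : IsContractive L
  idempotent : ∀ A, L (L A) = L A
  range_eq : LinearMap.range L = 𝓛

/-- The Choi–Effros product `A ⋆ B = L(AB)`. -/
def ceMul {p : ℕ} (L : BK p →ₗ[ℂ] BK p) (A B : BK p) : BK p := L (A * B)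

/-- `Q` is a central projection of `𝓛` with respect to the Choi–Effros product given by `L`. -/
structure IsCentralProjection {p : ℕ} (L : BK p →ₗ[ℂ] BK p) (𝓛 : Submodule ℂ (BK p))
    (Q : BK p) : Prop where
  mem : Q ∈ 𝓛
  selfAdjoint : star Q = Q
  idempotent : ceMul L Q Q = Q
  central : ∀ A ∈ 𝓛, ceMul L Q A = ceMul L A Q

/-- The set `Q ⋆ 𝓛 = {Q ⋆ A : A ∈ 𝓛}`. -/
def ceIdeal {p : ℕ} (L : BK p →ₗ[ℂ] BK p) (𝓛 : Submodule ℂ (BK p)) (Q : BK p) : Set (BK p) :=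
  {B | ∃ A ∈ 𝓛, ceMul L Q A = B}

/-- `𝓛`, with the product `A ⋆ B = L(AB)` given by the completely positive contractive idempotent
`L` with range `𝓛`, the involution of `B(K)` and the unit `L(I)`, is `*`-isomorphic to the algebra
of `q × q` matrices for some `q ≥ 1`. -/
def IsChoiEffrosFactorFor {p : ℕ} (L : BK p →ₗ[ℂ] BK p) (𝓛 : Submodule ℂ (BK p)) : Prop :=
  IsCPIdempotentOnto L 𝓛 ∧
    ∃ (q : ℕ) (Φ : Matrix (Fin q) (Fin q) ℂ →ₗ[ℂ] BK p),
      0 < q ∧ Function.Injective Φ ∧ LinearMap.range Φ = 𝓛 ∧ Φ 1 = L 1 ∧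
      (∀ A, Φ (star A) = star (Φ A)) ∧ ∀ A B, Φ (A * B) = ceMul L (Φ A) (Φ B)

/-- `𝓛 ⊆ B(K)` is a Choi–Effros factor. -/
def IsChoiEffrosFactor {p : ℕ} (𝓛 : Submodule ℂ (BK p)) : Prop :=
  ∃ L : BK p →ₗ[ℂ] BK p, IsChoiEffrosFactorFor L 𝓛

end QWeight

end

open QWeight

noncomputable section
namespace QWeight

set_option linter.unusedSectionVars false

/-! ### Completely positive maps between operator algebras -/

section CompletelyPositive

variable {X Y Z : Type*}
  [NormedAddCommGroup X] [InnerProductSpace ℂ X] [CompleteSpace X]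
  [NormedAddCommGroup Y] [InnerProductSpace ℂ Y] [CompleteSpace Y]
  [NormedAddCommGroup Z] [InnerProductSpace ℂ Z] [CompleteSpace Z]

/-! Write π_t for `bdryRep ω t`, ω_t for `cutoff ω t`, and 𝓛 for the range of ω. Since (ι + ω_tΛ)⁻¹
= ι − π_tΛ, one has π_t = ω_t − π_tΛω_t. On E(s,∞)AE(s,∞) with t ≤ s the cut-off ω_t takes the value
ω_s(A). As t → 0+, index zero kills the left side, so every limit point L of π_tΛ fixes ω_s(A), and
by normality fixes all of 𝓛. Also π_t = ω_t − ω_tΛπ_t takes values in 𝓛. So L is a completely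
positive contractive idempotent onto 𝓛 (`IsQWeightMap.isCPIdempotentOnto`).

A central projection Q splits 𝓛 through Θ(A) = L(QAQ) and the analogous Θ' for L(I) − Q, with Θ + Θ'
= ι on 𝓛 (`IsCornerPair`). The map Θπ_t is a completely positive contraction below π_t. It
determines a bounded weight map (`toWeight`), whose boundary representation at s is `stopped`. Both
are resolvent expressions, hence monotone (`IsCP.resolvent_sub`), so they are dominated by ω_t and,
for t ≤ s, by π_s. These bounds are uniform in t, and limits along an ultrafilter t → 0+ give a
q-subordinate η of ω (`IsCornerPair.isQSubordinate`).

The real point is that η is not too small. By `IsCornerPair.norm_sub_stopped_le`, Θπ_s(A) differs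
from the stopped map at A by at most ‖Θ'π_s(A)‖, uniformly in t ≤ s. For A in the range of Θ,
Θπ_sΛ(A) tends to A and Θ'π_sΛ(A) to 0 along the ultrafilter that produces L, so the boundary
representations of η at Λ(A) recover A (`IsCornerPair.range_eq`).

If ω is q-pure, the subordinates belonging to Q and L(I) − Q are comparable. Their ranges are
complementary, which forces one of them to vanish. Thus (𝓛, ⋆) has no nontrivial central projection.
The trace is a faithful positive functional on it, so Wedderburn's theorem leaves a single matrix
block, and a change of basis respects the involution (`exists_star_matrix_equiv`). -/

theorem inner_apply_star (A : X →L[ℂ] X) (x y : X) : ⟪x, star A y⟫_ℂ = ⟪A x, y⟫_ℂ :=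
  ContinuousLinearMap.adjoint_inner_right A x y

theorem inner_self_nonneg' (x : X) : 0 ≤ ⟪x, x⟫_ℂ := by
  rw [inner_self_eq_norm_sq_to_K]
  have : (0 : ℝ) ≤ ‖x‖ ^ 2 := sq_nonneg _
  change (0 : ℂ) ≤ ((‖x‖ : ℝ) : ℂ) ^ 2
  exact_mod_cast this

theorem exists_eq_star_mul_self {T : X →L[ℂ] X} (h : 0 ≤ T) : ∃ B : X →L[ℂ] X, T = star B * B :=
  CStarAlgebra.nonneg_iff_eq_star_mul_self.1 h

theorem IsCP.zero : IsCP (0 : (X →L[ℂ] X) →ₗ[ℂ] (Y →L[ℂ] Y)) := by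
  intro n A f
  simp

theorem IsCP.id : IsCP (LinearMap.id : (X →L[ℂ] X) →ₗ[ℂ] (X →L[ℂ] X)) := by
  intro n A f
  have : ∑ i, ∑ j, ⟪f i, (star (A i) * A j) (f j)⟫_ℂ = ⟪∑ i, A i (f i), ∑ i, A i (f i)⟫_ℂ := by
    rw [sum_inner]
    simp_rw [inner_sum]
    refine Finset.sum_congr rfl fun i _ => Finset.sum_congr rfl fun j _ => ?_
    exact inner_apply_star (A i) (f i) (A j (f j))
  simp only [LinearMap.id_coe, id_eq, this]
  exact inner_self_nonneg' _

theorem IsCP.add {φ ψ : (X →L[ℂ] X) →ₗ[ℂ] (Y →L[ℂ] Y)} (hφ : IsCP φ) (hψ : IsCP ψ) :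
    IsCP (φ + ψ) := by
  intro n A f
  simpa [inner_add_right, Finset.sum_add_distrib] using add_nonneg (hφ n A f) (hψ n A f)

theorem IsCP.congr {φ ψ : (X →L[ℂ] X) →ₗ[ℂ] (Y →L[ℂ] Y)} (hφ : IsCP φ)
    (h : ∀ A, φ A = ψ A) : IsCP ψ :=
  LinearMap.ext h ▸ hφ

/-- A map of the form `A ↦ S* J(A) S`, with `J` a `*`-homomorphism, is completely positive;
more generally a composition with such a map is. -/
theorem IsCP.comp_conj {φ : (Y →L[ℂ] Y) →ₗ[ℂ] (Z →L[ℂ] Z)} (hφ : IsCP φ)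
    (ψ : (X →L[ℂ] X) →ₗ[ℂ] (Y →L[ℂ] Y)) (T : (X →L[ℂ] X) → (Y →L[ℂ] Y))
    (hψ : ∀ A B, ψ (star A * B) = star (T A) * T B) : IsCP (φ ∘ₗ ψ) := by
  intro n A f
  simpa [hψ] using hφ n (fun i => T (A i)) f

theorem isCP_of_conj (ψ : (X →L[ℂ] X) →ₗ[ℂ] (Y →L[ℂ] Y)) (T : (X →L[ℂ] X) → (Y →L[ℂ] Y))
    (hψ : ∀ A B, ψ (star A * B) = star (T A) * T B) : IsCP ψ :=
  IsCP.id.comp_conj ψ T hψ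

theorem isCP_sandwich {S : X →L[ℂ] X} (hS : star S = S) : IsCP (sandwich S) :=
  isCP_of_conj _ (fun A => A * S) fun A B => by simp [sandwich, hS, mul_assoc]

/-! ### Positive operator matrices -/

section Comp

variable {n : ℕ}

/-- The operator matrix `(Mᵢⱼ)` as an operator on the direct sum. -/
def blockOp (M : Fin n → Fin n → (Y →L[ℂ] Y)) :
    PiLp 2 (fun _ : Fin n => Y) →L[ℂ] PiLp 2 (fun _ : Fin n => Y) :=
  ((PiLp.continuousLinearEquiv 2 ℂ (fun _ : Fin n => Y)).symm :
    (Fin n → Y) →L[ℂ] PiLp 2 (fun _ : Fin n => Y)) ∘L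
  ContinuousLinearMap.pi fun i => ∑ j, M i j ∘L PiLp.proj 2 (fun _ : Fin n => Y) j

theorem blockOp_apply (M : Fin n → Fin n → (Y →L[ℂ] Y)) (x : PiLp 2 (fun _ : Fin n => Y))
    (i : Fin n) : blockOp M x i = ∑ j, M i j (x j) := by
  simp [blockOp]

theorem inner_blockOp (M : Fin n → Fin n → (Y →L[ℂ] Y)) (x y : PiLp 2 (fun _ : Fin n => Y)) :
    ⟪x, blockOp M y⟫_ℂ = ∑ i, ∑ j, ⟪x i, M i j (y j)⟫_ℂ := by
  simp [PiLp.inner_apply, blockOp_apply, inner_sum]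

theorem isPositive_of_inner_nonneg (T : X →L[ℂ] X) (h : ∀ x, 0 ≤ ⟪x, T x⟫_ℂ) : 0 ≤ T := by
  rw [ContinuousLinearMap.nonneg_iff_isPositive, ContinuousLinearMap.isPositive_iff_complex]
  intro x
  have h1 := h x
  rw [← inner_conj_symm] at h1
  have h2 : 0 ≤ ⟪T x, x⟫_ℂ := by
    have := star_nonneg_iff.2 h1
    simpa using this
  rw [Complex.nonneg_iff] at h2
  refine ⟨?_, h2.1⟩
  apply Complex.ext <;> simp [h2.2.symm]

theorem inner_nonneg_of_nonneg {T : X →L[ℂ] X} (h : 0 ≤ T) (x : X) : 0 ≤ ⟪x, T x⟫_ℂ := by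
  obtain ⟨B, rfl⟩ := exists_eq_star_mul_self h
  change 0 ≤ ⟪x, star B (B x)⟫_ℂ
  rw [inner_apply_star]
  exact inner_self_nonneg' _

/-- A positive operator matrix is of the form `Mᵢⱼ = ∑ₖ Bₖᵢ* Bₖⱼ`. -/
theorem exists_factor_of_positive (M : Fin n → Fin n → (Y →L[ℂ] Y))
    (hM : ∀ f : Fin n → Y, 0 ≤ ∑ i, ∑ j, ⟪f i, M i j (f j)⟫_ℂ) :
    ∃ B : Fin n → Fin n → (Y →L[ℂ] Y), ∀ i j, M i j = ∑ k, star (B k i) * B k j := by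
  have h : 0 ≤ blockOp M := isPositive_of_inner_nonneg _ fun x => by
    rw [inner_blockOp]; exact hM _
  -- The blocks of a square root factor B of the whole matrix, M = B*B, are the required operators:
  -- the (i, j) block of B*B is the sum over the rows k of B.
  obtain ⟨B, hB⟩ := exists_eq_star_mul_self h
  let E : Fin n → (Y →L[ℂ] PiLp 2 (fun _ : Fin n => Y)) := fun i =>
    ((PiLp.continuousLinearEquiv 2 ℂ (fun _ : Fin n => Y)).symm :
      (Fin n → Y) →L[ℂ] PiLp 2 (fun _ : Fin n => Y)) ∘L
      ContinuousLinearMap.single ℂ (fun _ : Fin n => Y) i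
  have hE : ∀ i y, E i y = WithLp.toLp 2 (Pi.single i y) := fun i y => rfl
  refine ⟨fun k i => PiLp.proj 2 (fun _ : Fin n => Y) k ∘L B ∘L E i, fun i j => ?_⟩
  ext1 y
  refine ext_inner_left ℂ fun x => ?_
  have h1 : ⟪E i x, blockOp M (E j y)⟫_ℂ = ⟪x, M i j y⟫_ℂ := by
    rw [inner_blockOp]
    simp only [hE]
    rw [Finset.sum_eq_single i, Finset.sum_eq_single j]
    · simp
    · intro b _ hb; simp [Pi.single_eq_of_ne hb]
    · simp
    · intro b _ hb; simp [Pi.single_eq_of_ne hb]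
    · simp
  rw [← h1, hB]
  change ⟪E i x, star B (B (E j y))⟫_ℂ = _
  rw [inner_apply_star, PiLp.inner_apply, _root_.sum_apply, inner_sum]
  refine Finset.sum_congr rfl fun k _ => ?_
  exact (inner_apply_star (PiLp.proj 2 (fun _ : Fin n => Y) k ∘L B ∘L E i) x _).symm

end Comp

/-- `IsCP` tests only matrices of the form (Bᵢ* Bⱼ). The positive matrix (ψ(Aᵢ* Aⱼ)) is a finite sum
of such matrices, so φ can be applied to it. -/
theorem IsCP.comp {φ : (Y →L[ℂ] Y) →ₗ[ℂ] (Z →L[ℂ] Z)} {ψ : (X →L[ℂ] X) →ₗ[ℂ] (Y →L[ℂ] Y)}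
    (hφ : IsCP φ) (hψ : IsCP ψ) : IsCP (φ ∘ₗ ψ) := by
  intro n A f
  obtain ⟨B, hB⟩ := exists_factor_of_positive (fun i j => ψ (star (A i) * A j))
    fun f => hψ n A f
  have : ∑ i, ∑ j, ⟪f i, (φ ∘ₗ ψ) (star (A i) * A j) (f j)⟫_ℂ =
      ∑ k, ∑ i, ∑ j, ⟪f i, φ (star (B k i) * B k j) (f j)⟫_ℂ := by
    simp only [LinearMap.comp_apply, hB, map_sum, _root_.sum_apply, inner_sum]
    conv_rhs => rw [Finset.sum_comm]
    exact Finset.sum_congr rfl fun i _ => Finset.sum_comm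
  rw [this]
  exact Finset.sum_nonneg fun k _ => hφ n (B k) f

theorem IsCP.inner_two {φ : (X →L[ℂ] X) →ₗ[ℂ] (Y →L[ℂ] Y)} (hφ : IsCP φ) (A : X →L[ℂ] X)
    (f g : Y) :
    0 ≤ ⟪f, φ (star A * A) f⟫_ℂ + ⟪f, φ (star A) g⟫_ℂ + (⟪g, φ A f⟫_ℂ + ⟪g, φ 1 g⟫_ℂ) := by
  simpa [Fin.sum_univ_two] using hφ 2 ![A, 1] ![f, g]

theorem IsCP.map_nonneg {φ : (X →L[ℂ] X) →ₗ[ℂ] (Y →L[ℂ] Y)} (hφ : IsCP φ) {A : X →L[ℂ] X}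
    (hA : 0 ≤ A) : 0 ≤ φ A := by
  obtain ⟨B, rfl⟩ := exists_eq_star_mul_self hA
  refine isPositive_of_inner_nonneg _ fun x => ?_
  simpa using hφ 1 ![B] ![x]

theorem IsCP.map_le_map {φ : (X →L[ℂ] X) →ₗ[ℂ] (Y →L[ℂ] Y)} (hφ : IsCP φ) {A B : X →L[ℂ] X}
    (h : A ≤ B) : φ A ≤ φ B := by
  have := hφ.map_nonneg (sub_nonneg.2 h)
  rwa [map_sub, sub_nonneg] at this

/-- Positivity of the 2 × 2 form built on A and I makes its off-diagonal part real. Testing it with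
g and with ig yields the imaginary and the real part of the identity. -/
theorem IsCP.map_star {φ : (X →L[ℂ] X) →ₗ[ℂ] (Y →L[ℂ] Y)} (hφ : IsCP φ) (A : X →L[ℂ] X) :
    φ (star A) = star (φ A) := by
  have h1 : ∀ f, (⟪f, φ (star A * A) f⟫_ℂ).im = 0 := fun f => by
    have := hφ 1 ![A] ![f]
    simp [Complex.nonneg_iff] at this
    exact this.2.symm
  have h2 : ∀ f, (⟪f, φ 1 f⟫_ℂ).im = 0 := fun f => by
    have := hφ 1 ![1] ![f]
    simp [Complex.nonneg_iff] at this
    exact this.2.symm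
  have h3 : ∀ f g, (⟪f, φ (star A) g⟫_ℂ).im + (⟪g, φ A f⟫_ℂ).im = 0 := fun f g => by
    have := (Complex.nonneg_iff.1 (hφ.inner_two A f g)).2
    simp only [Complex.add_im, h1, h2] at this
    linarith
  ext1 g
  refine ext_inner_left ℂ fun f => ?_
  rw [inner_apply_star, ← inner_conj_symm (φ A f) g]
  apply Complex.ext
  · have := h3 f (Complex.I • g)
    simp only [map_smul, inner_smul_left, inner_smul_right, Complex.conj_I, Complex.mul_im,
      Complex.I_re, Complex.I_im, Complex.neg_re, Complex.neg_im] at this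
    rw [Complex.conj_re]
    linarith
  · have := h3 f g
    rw [Complex.conj_im]
    linarith

/-- The Kadison–Schwarz inequality. -/
theorem IsCP.schwarz {φ : (X →L[ℂ] X) →ₗ[ℂ] (Y →L[ℂ] Y)} (hφ : IsCP φ) (A : X →L[ℂ] X) (f : Y) :
    ‖φ A f‖ ^ 2 ≤ ‖φ 1‖ * (⟪f, φ (star A * A) f⟫_ℂ).re := by
  set a := (⟪f, φ (star A * A) f⟫_ℂ).re
  set M := ‖φ 1‖
  set v := φ A f with hv
  -- The 2 × 2 positivity at the vectors f and −cφ(A)f gives a quadratic in c that is never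
  -- negative.
  have key : ∀ c : ℝ, 0 ≤ a - 2 * c * ‖v‖ ^ 2 + c ^ 2 * (M * ‖v‖ ^ 2) := fun c => by
    have h := (Complex.nonneg_iff.1 (hφ.inner_two A f (-((c : ℂ) • v)))).1
    rw [hφ.map_star, inner_apply_star, ← hv] at h
    simp only [Complex.add_re, map_neg, map_smul, inner_neg_left, inner_neg_right, inner_smul_left,
      inner_smul_right, Complex.conj_ofReal, inner_self_eq_norm_sq_to_K] at h
    have h5 : (⟪v, φ 1 v⟫_ℂ).re ≤ M * ‖v‖ ^ 2 := by
      calc (⟪v, φ 1 v⟫_ℂ).re ≤ ‖⟪v, φ 1 v⟫_ℂ‖ := Complex.re_le_norm _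
        _ ≤ ‖v‖ * ‖φ 1 v‖ := norm_inner_le_norm _ _
        _ ≤ ‖v‖ * (M * ‖v‖) := by gcongr; exact ContinuousLinearMap.le_opNorm _ _
        _ = M * ‖v‖ ^ 2 := by ring
    have h6 : (Complex.re (-((c:ℂ) * ((‖v‖ : ℂ)) ^ 2))) = - (c * ‖v‖ ^ 2) := by
      norm_cast
    have h7 : (Complex.re (-((c:ℂ) * -((c : ℂ) * ⟪v, φ 1 v⟫_ℂ)))) = c ^ 2 * (⟪v, φ 1 v⟫_ℂ).re := by
      rw [mul_neg, neg_neg, Complex.re_ofReal_mul, Complex.re_ofReal_mul]; ring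
    have h8 := mul_le_mul_of_nonneg_left h5 (sq_nonneg c)
    simp only [Complex.coe_algebraMap] at h
    rw [h6, h7] at h
    linarith
  have hM : 0 ≤ M := norm_nonneg _
  rcases hM.eq_or_lt with h0 | hpos
  · rw [← h0] at key ⊢
    rw [zero_mul]
    by_contra! hlt
    -- When ‖φ(I)‖ = 0 the quadratic term is absent, and this c gives the value −1.
    have := key ((a + 1) / (2 * ‖v‖ ^ 2))
    have h1 : 2 * ((a + 1) / (2 * ‖v‖ ^ 2)) * ‖v‖ ^ 2 = a + 1 := by
      have := hlt.ne'
      generalize ‖v‖ ^ 2 = w at *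
      field_simp
    rw [h1] at this
    linarith
  -- The minimum of the quadratic is at c = 1/M.
  · have := key M⁻¹
    have h1 : M⁻¹ ^ 2 * (M * ‖v‖ ^ 2) = M⁻¹ * ‖v‖ ^ 2 := by field_simp
    rw [h1] at this
    have h2 : M⁻¹ * ‖v‖ ^ 2 ≤ a := by linarith
    calc ‖v‖ ^ 2 = M * (M⁻¹ * ‖v‖ ^ 2) := by field_simp
      _ ≤ M * a := by gcongr

theorem star_mul_self_le_norm_sq (A : X →L[ℂ] X) :
    star A * A ≤ ((‖A‖ ^ 2 : ℝ) : ℂ) • (1 : X →L[ℂ] X) := by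
  have := CStarAlgebra.star_mul_le_algebraMap_norm_sq (a := A)
  rw [Algebra.algebraMap_eq_smul_one] at this
  exact_mod_cast this

theorem IsCP.norm_le {φ : (X →L[ℂ] X) →ₗ[ℂ] (Y →L[ℂ] Y)} (hφ : IsCP φ) (A : X →L[ℂ] X) :
    ‖φ A‖ ≤ ‖φ 1‖ * ‖A‖ := by
  refine ContinuousLinearMap.opNorm_le_bound _ (by positivity) fun f => ?_
  refine le_of_sq_le_sq ?_ (by positivity)
  refine (hφ.schwarz A f).trans ?_
  have h1 := inner_nonneg_of_nonneg (sub_nonneg.2 (hφ.map_le_map (star_mul_self_le_norm_sq A))) f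
  rw [map_smul] at h1
  have h2 := (Complex.nonneg_iff.1 h1).1
  rw [_root_.sub_apply, inner_sub_right, _root_.smul_apply,
    inner_smul_right, Complex.sub_re, Complex.re_ofReal_mul] at h2
  have h3 : (⟪f, φ 1 f⟫_ℂ).re ≤ ‖φ 1‖ * ‖f‖ ^ 2 := by
    calc (⟪f, φ 1 f⟫_ℂ).re ≤ ‖⟪f, φ 1 f⟫_ℂ‖ := Complex.re_le_norm _
      _ ≤ ‖f‖ * ‖φ 1 f‖ := norm_inner_le_norm _ _
      _ ≤ ‖f‖ * (‖φ 1‖ * ‖f‖) := by gcongr; exact ContinuousLinearMap.le_opNorm _ _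
      _ = ‖φ 1‖ * ‖f‖ ^ 2 := by ring
  calc ‖φ 1‖ * (⟪f, φ (star A * A) f⟫_ℂ).re ≤ ‖φ 1‖ * (‖A‖ ^ 2 * (‖φ 1‖ * ‖f‖ ^ 2)) := by
        gcongr; nlinarith [sq_nonneg ‖A‖]
    _ = (‖φ 1‖ * ‖A‖ * ‖f‖) ^ 2 := by ring

theorem IsCP.isContractive {φ : (X →L[ℂ] X) →ₗ[ℂ] (Y →L[ℂ] Y)} (hφ : IsCP φ) (h : ‖φ 1‖ ≤ 1) :
    IsContractive φ := fun A =>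
  (hφ.norm_le A).trans (mul_le_of_le_one_left (norm_nonneg _) h)

theorem IsCP.norm_one_le_of_le {φ ψ : (X →L[ℂ] X) →ₗ[ℂ] (Y →L[ℂ] Y)} (hψ : IsCP ψ)
    (h : IsCP (φ - ψ)) : ‖ψ 1‖ ≤ ‖φ 1‖ := by
  refine CStarAlgebra.norm_le_norm_of_nonneg_of_le (hψ.map_nonneg zero_le_one) ?_
  have := h.map_nonneg zero_le_one
  rwa [LinearMap.sub_apply, sub_nonneg] at this

theorem IsContractive.norm_one_le {φ : (X →L[ℂ] X) →ₗ[ℂ] (Y →L[ℂ] Y)} (h : IsContractive φ) :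
    ‖φ 1‖ ≤ 1 :=
  (h 1).trans ContinuousLinearMap.norm_id_le

theorem IsContractive.of_le {φ ψ : (X →L[ℂ] X) →ₗ[ℂ] (Y →L[ℂ] Y)} (hφ : IsContractive φ)
    (hψ : IsCP ψ) (h : IsCP (φ - ψ)) : IsContractive ψ :=
  hψ.isContractive ((hψ.norm_one_le_of_le h).trans hφ.norm_one_le)

theorem IsCP.of_tendsto {ι : Type*} {U : Filter ι} [U.NeBot]
    {T : ι → (X →L[ℂ] X) →ₗ[ℂ] (Y →L[ℂ] Y)} {φ : (X →L[ℂ] X) →ₗ[ℂ] (Y →L[ℂ] Y)}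
    (h : ∀ A, Tendsto (fun t => T t A) U (𝓝 (φ A))) (hT : ∀ᶠ t in U, IsCP (T t)) : IsCP φ := by
  intro n A f
  have : Tendsto (fun t => ∑ i, ∑ j, ⟪f i, T t (star (A i) * A j) (f j)⟫_ℂ) U
      (𝓝 (∑ i, ∑ j, ⟪f i, φ (star (A i) * A j) (f j)⟫_ℂ)) := by
    refine tendsto_finsetSum _ fun i _ => tendsto_finsetSum _ fun j _ => ?_
    refine tendsto_const_nhds.inner ?_
    exact ((ContinuousLinearMap.apply ℂ Y (f j)).continuous.tendsto _).comp (h _)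
  exact ge_of_tendsto this (hT.mono fun t ht => ht n A f)

end CompletelyPositive
end QWeight
end

noncomputable section
namespace QWeight

set_option linter.unusedSectionVars false

/-! ### Pointwise limits and Neumann series -/

section Limits

variable {ι V W : Type*} [AddCommGroup V] [Module ℂ V] [NormedAddCommGroup W] [NormedSpace ℂ W]
  [FiniteDimensional ℂ W]

theorem exists_tendsto_of_bounded (U : Ultrafilter ι) {u : ι → W} {C : ℝ}
    (h : ∀ᶠ t in U, ‖u t‖ ≤ C) : ∃ a, Tendsto u U (𝓝 a) := by
  have : ProperSpace W := FiniteDimensional.proper ℂ W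
  obtain ⟨a, -, ha⟩ := (isCompact_closedBall (0 : W) C).ultrafilter_le_nhds (U.map u) (by
    rw [le_principal_iff]
    change ∀ᶠ t in U, u t ∈ Metric.closedBall 0 C
    exact h.mono fun t ht => by simpa using ht)
  exact ⟨a, ha⟩

/-- Bounded functions into a finite-dimensional space converge along an ultrafilter, so one
ultrafilter serves all v at once, with no topology on V and no choice of subsequences. -/
theorem exists_pointwise_limit (U : Ultrafilter ι) (T : ι → V →ₗ[ℂ] W)
    (h : ∀ v, ∃ C : ℝ, ∀ᶠ t in U, ‖T t v‖ ≤ C) :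
    ∃ T' : V →ₗ[ℂ] W, ∀ v, Tendsto (fun t => T t v) U (𝓝 (T' v)) := by
  have h' : ∀ v, ∃ a, Tendsto (fun t => T t v) U (𝓝 a) := fun v =>
    let ⟨_, hC⟩ := h v
    exists_tendsto_of_bounded U hC
  choose f hf using h'
  refine ⟨{ toFun := f, map_add' := fun x y => ?_, map_smul' := fun c x => ?_ }, hf⟩
  · refine tendsto_nhds_unique (hf _) ?_
    simpa using (hf x).add (hf y)
  · refine tendsto_nhds_unique (hf _) ?_
    simpa using (hf x).const_smul c

theorem isUnit_one_sub_of_norm_le {T : Module.End ℂ W} {r : ℝ} (hr : r < 1)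
    (hT : ∀ A, ‖T A‖ ≤ r * ‖A‖) : IsUnit (1 - T) := by
  rw [LinearMap.isUnit_iff_ker_eq_bot, LinearMap.ker_eq_bot']
  intro A hA
  have h1 : A = T A := by simpa [sub_eq_zero] using hA
  have h2 := hT A
  rw [← h1] at h2
  have : ‖A‖ ≤ 0 := by nlinarith [norm_nonneg A]
  simpa using this

theorem norm_pow_apply_le {T : Module.End ℂ W} {r : ℝ} (h0 : 0 ≤ r)
    (hT : ∀ A, ‖T A‖ ≤ r * ‖A‖) (n : ℕ) (A : W) : ‖(T ^ n) A‖ ≤ r ^ n * ‖A‖ := by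
  induction n with
  | zero => simp
  | succ n ih =>
    rw [pow_succ', Module.End.mul_apply, pow_succ']
    calc _ ≤ r * ‖(T ^ n) A‖ := hT _
      _ ≤ r * (r ^ n * ‖A‖) := by gcongr
      _ = _ := by ring

theorem tendsto_neumann {T : Module.End ℂ W} {r : ℝ} (h0 : 0 ≤ r) (hr : r < 1)
    (hT : ∀ A, ‖T A‖ ≤ r * ‖A‖) (A : W) :
    Tendsto (fun n => (∑ k ∈ Finset.range n, T ^ k) A) atTop (𝓝 (Ring.inverse (1 - T) A)) := by
  have hu := isUnit_one_sub_of_norm_le hr hT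
  set B := Ring.inverse (1 - T) A
  have hB : (1 - T) B = A := by
    rw [← Module.End.mul_apply, Ring.mul_inverse_cancel _ hu, Module.End.one_apply]
  have h1 : ∀ n, (∑ k ∈ Finset.range n, T ^ k) A = B - (T ^ n) B := fun n => by
    rw [← hB, ← Module.End.mul_apply, geom_sum_mul_neg]
    simp
  simp_rw [h1]
  have h2 : Tendsto (fun n => (T ^ n) B) atTop (𝓝 0) := by
    refine squeeze_zero_norm (fun n => norm_pow_apply_le h0 hT n B) ?_
    simpa using (tendsto_pow_atTop_nhds_zero_of_lt_one h0 hr).mul_const ‖B‖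
  simpa using tendsto_const_nhds.sub h2

end Limits

/-- The partial sums of ∑ Tᵏ are completely positive, and complete positivity survives pointwise
limits. -/
theorem IsCP.neumann {Y : Type*} [NormedAddCommGroup Y] [InnerProductSpace ℂ Y]
    [FiniteDimensional ℂ Y] [CompleteSpace Y] {T : Module.End ℂ (Y →L[ℂ] Y)} (hcp : IsCP T)
    {r : ℝ} (h0 : 0 ≤ r) (hr : r < 1) (hT : ∀ A, ‖T A‖ ≤ r * ‖A‖) :
    IsCP (Ring.inverse (1 - T) : Module.End ℂ (Y →L[ℂ] Y)) := by
  have hpow : ∀ k, IsCP (T ^ k : Module.End ℂ (Y →L[ℂ] Y)) := fun k => by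
    induction k with
    | zero => exact IsCP.id
    | succ n ih => rw [pow_succ']; exact hcp.comp ih
  have hsum : ∀ n, IsCP (∑ k ∈ Finset.range n, T ^ k : Module.End ℂ (Y →L[ℂ] Y)) := fun n => by
    induction n with
    | zero => simpa using IsCP.zero
    | succ n ih => rw [Finset.sum_range_succ]; exact ih.add (hpow n)
  exact IsCP.of_tendsto (tendsto_neumann h0 hr hT) (Eventually.of_forall hsum)

/-! ### Normal functionals -/

section Normal

variable {X Y Z : Type*}
  [NormedAddCommGroup X] [InnerProductSpace ℂ X] [CompleteSpace X]
  [NormedAddCommGroup Y] [InnerProductSpace ℂ Y] [CompleteSpace Y]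
  [NormedAddCommGroup Z] [InnerProductSpace ℂ Z] [CompleteSpace Z]

theorem lp_two_summable (F : lp (fun _ : ℕ => X) 2) : Summable fun k => ‖F k‖ ^ 2 := by
  have := (lp.hasSum_norm (p := 2) (by norm_num) F).summable
  simpa using this

/-- The operator `A ⊗ 1` on `ℓ²(ℕ, X)`. -/
def amplify (A : X →L[ℂ] X) : lp (fun _ : ℕ => X) 2 →ₗ[ℂ] lp (fun _ : ℕ => X) 2 where
  toFun F := ⟨fun k => A (F k), by
    refine memℓp_gen ?_
    simp only [ENNReal.toReal_ofNat, Real.rpow_ofNat]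
    refine Summable.of_nonneg_of_le (fun k => by positivity) (fun k => ?_)
      ((lp_two_summable F).mul_left (‖A‖ ^ 2))
    rw [← mul_pow]
    gcongr
    exact A.le_opNorm _⟩
  map_add' F G := by ext k; exact A.map_add _ _
  map_smul' c F := by ext k; exact A.map_smul c _

theorem amplify_apply (A : X →L[ℂ] X) (F : lp (fun _ : ℕ => X) 2) (k : ℕ) :
    amplify A F k = A (F k) := rfl

theorem sigmaWeakFunctional_eq_inner (FG : lp (fun _ : ℕ => X) 2 × lp (fun _ : ℕ => X) 2)
    (A : X →L[ℂ] X) : sigmaWeakFunctional FG A = ⟪FG.1, amplify A FG.2⟫_ℂ :=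
  (lp.inner_eq_tsum FG.1 (amplify A FG.2)).symm

/-- `B ↦ (B ⊗ 1) F` as a linear map. -/
def amplifyAt (F : lp (fun _ : ℕ => X) 2) : (X →L[ℂ] X) →ₗ[ℂ] lp (fun _ : ℕ => X) 2 where
  toFun A := amplify A F
  map_add' A B := by ext k; simp [amplify_apply]
  map_smul' c A := by ext k; simp [amplify_apply]

/-- The functional `sigmaWeakFunctional` as a linear map. -/
def sigmaWeakLin (FG : lp (fun _ : ℕ => X) 2 × lp (fun _ : ℕ => X) 2) :
    (X →L[ℂ] X) →ₗ[ℂ] ℂ where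
  toFun := sigmaWeakFunctional FG
  map_add' A B := by
    simp only [sigmaWeakFunctional_eq_inner]
    rw [← inner_add_right]
    exact congrArg _ ((amplifyAt FG.2).map_add A B)
  map_smul' c A := by
    simp only [sigmaWeakFunctional_eq_inner, RingHom.id_apply, smul_eq_mul]
    rw [← inner_smul_right]
    exact congrArg _ ((amplifyAt FG.2).map_smul c A)

variable (X) in
/-- The space of σ-weakly continuous functionals. -/
def normalFunctionals : Submodule ℂ ((X →L[ℂ] X) →ₗ[ℂ] ℂ) :=
  Submodule.span ℂ (Set.range sigmaWeakLin)

/-- A weak topology induced by a family of functionals has exactly their linear span as its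
continuous functionals. -/
theorem mem_normalFunctionals_iff (τ : (X →L[ℂ] X) →ₗ[ℂ] ℂ) :
    τ ∈ normalFunctionals X ↔ Continuous[sigmaWeakTopology, inferInstance] τ :=
  LinearMap.mem_span_iff_continuous τ

/-- The functional `A ↦ (f, A g)`. -/
def matrixCoeff (f g : Y) : (Y →L[ℂ] Y) →ₗ[ℂ] ℂ where
  toFun A := ⟪f, A g⟫_ℂ
  map_add' A B := by simp
  map_smul' c A := by simp

theorem isNormalMap_iff (φ : (X →L[ℂ] X) →ₗ[ℂ] (Y →L[ℂ] Y)) :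
    IsNormalMap φ ↔ ∀ f g, matrixCoeff f g ∘ₗ φ ∈ normalFunctionals X := by
  simp only [mem_normalFunctionals_iff]
  rfl

theorem inner_amplify_star_mul (B : X →L[ℂ] X) (F G : lp (fun _ : ℕ => X) 2) :
    ⟪F, amplify (star B * B) G⟫_ℂ = ⟪amplify B F, amplify B G⟫_ℂ := by
  rw [lp.inner_eq_tsum, lp.inner_eq_tsum]
  exact tsum_congr fun k => inner_apply_star B (F k) (B (G k))

theorem exists_bound_of_mem_normalFunctionals {τ : (X →L[ℂ] X) →ₗ[ℂ] ℂ}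
    (hτ : τ ∈ normalFunctionals X) :
    ∃ (s : Finset (lp (fun _ : ℕ => X) 2)) (C : ℝ), 0 ≤ C ∧
      ∀ B, ‖τ (star B * B)‖ ≤ C * ∑ ζ ∈ s, ‖amplify B ζ‖ ^ 2 := by
  classical
  induction hτ using Submodule.span_induction with
  | mem τ h =>
    obtain ⟨⟨F, G⟩, rfl⟩ := h
    refine ⟨{F, G}, 1, zero_le_one, fun B => ?_⟩
    change ‖sigmaWeakFunctional (F, G) (star B * B)‖ ≤ _
    rw [sigmaWeakFunctional_eq_inner, inner_amplify_star_mul, one_mul]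
    refine (norm_inner_le_norm _ _).trans ?_
    -- The set {F, G} has a single element when F = G, so its sum is then only ‖(B ⊗ 1)F‖².
    by_cases h : F = G
    · subst h; simp [sq]
    · rw [Finset.sum_pair h]
      nlinarith [sq_nonneg (‖amplify B F‖ - ‖amplify B G‖), sq_nonneg (‖amplify B F‖),
        sq_nonneg (‖amplify B G‖)]
  | zero => exact ⟨∅, 0, le_rfl, by simp⟩
  | add τ σ _ _ h1 h2 =>
    obtain ⟨s, C, hC, h1⟩ := h1
    obtain ⟨s', C', hC', h2⟩ := h2
    refine ⟨s ∪ s', C + C', by positivity, fun B => ?_⟩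
    have e1 : ∑ ζ ∈ s, ‖amplify B ζ‖ ^ 2 ≤ ∑ ζ ∈ s ∪ s', ‖amplify B ζ‖ ^ 2 :=
      Finset.sum_le_sum_of_subset_of_nonneg Finset.subset_union_left fun _ _ _ => by positivity
    have e2 : ∑ ζ ∈ s', ‖amplify B ζ‖ ^ 2 ≤ ∑ ζ ∈ s ∪ s', ‖amplify B ζ‖ ^ 2 :=
      Finset.sum_le_sum_of_subset_of_nonneg Finset.subset_union_right fun _ _ _ => by positivity
    calc _ ≤ ‖τ (star B * B)‖ + ‖σ (star B * B)‖ := norm_add_le _ _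
      _ ≤ C * _ + C' * _ := add_le_add ((h1 B).trans (mul_le_mul_of_nonneg_left e1 hC))
          ((h2 B).trans (mul_le_mul_of_nonneg_left e2 hC'))
      _ = _ := by ring
  | smul c τ _ h =>
    obtain ⟨s, C, hC, h⟩ := h
    refine ⟨s, ‖c‖ * C, by positivity, fun B => ?_⟩
    rw [LinearMap.smul_apply, norm_smul, mul_assoc]
    gcongr
    exact h B

/-- A functional bounded in terms of a linear map into a Hilbert space factors through it. -/
theorem exists_inner_of_norm_le {V E : Type*} [AddCommGroup V] [Module ℂ V]
    [NormedAddCommGroup E] [InnerProductSpace ℂ E] [CompleteSpace E] (Φ : V →ₗ[ℂ] E)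
    (τ : V →ₗ[ℂ] ℂ) (C : ℝ) (h : ∀ v, ‖τ v‖ ≤ C * ‖Φ v‖) :
    ∃ e : E, ∀ v, τ v = ⟪e, Φ v⟫_ℂ := by
  -- A linear section g of Φ transports τ to a bounded functional on the range of Φ, which need not
  -- be closed. Hahn–Banach extends it to E and Riesz represents it.
  obtain ⟨g, hg⟩ := Φ.rangeRestrict.exists_rightInverse_of_surjective Φ.range_rangeRestrict
  have hg' : ∀ y, Φ (g y) = y := fun y => congrArg Subtype.val (LinearMap.congr_fun hg y)
  let f : StrongDual ℂ (LinearMap.range Φ) := (τ ∘ₗ g).mkContinuous C fun y => by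
    have := h (g y)
    rwa [hg'] at this
  obtain ⟨F, hF, -⟩ := exists_extension_norm_eq _ f
  refine ⟨(InnerProductSpace.toDual ℂ E).symm F, fun v => ?_⟩
  rw [InnerProductSpace.toDual_symm_apply]
  have h1 := hF ⟨Φ v, v, rfl⟩
  rw [h1]
  change τ v = τ (g _)
  have h2 := h (v - g ⟨Φ v, v, rfl⟩)
  rw [map_sub, map_sub, hg', sub_self, norm_zero, mul_zero] at h2
  exact sub_eq_zero.1 (norm_le_zero_iff.1 h2)

/-- The bound says that τ factors boundedly through B ↦ ((B ⊗ 1)ζ)_ζ, a map into a finite Hilbert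
sum. The Riesz vector of the factored functional has components e_ζ, and τ is the sum of the normal
functionals of the pairs (e_ζ, ζ). -/
theorem mem_normalFunctionals_of_bound (τ : (X →L[ℂ] X) →ₗ[ℂ] ℂ)
    (s : Finset (lp (fun _ : ℕ => X) 2)) (C : ℝ)
    (h : ∀ B, ‖τ B‖ ^ 2 ≤ C * ∑ ζ ∈ s, ‖amplify B ζ‖ ^ 2) : τ ∈ normalFunctionals X := by
  let Φ : (X →L[ℂ] X) →ₗ[ℂ] PiLp 2 (fun _ : s => lp (fun _ : ℕ => X) 2) :=
    (WithLp.linearEquiv 2 ℂ (s → lp (fun _ : ℕ => X) 2)).symm.toLinearMap ∘ₗ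
      LinearMap.pi fun ζ : s => amplifyAt ζ.1
  have hΦ : ∀ B (ζ : s), Φ B ζ = amplify B ζ.1 := fun B ζ => rfl
  obtain ⟨e, he⟩ := exists_inner_of_norm_le Φ τ √C fun B => by
    rw [← Real.sqrt_sq (norm_nonneg (Φ B)), PiLp.norm_sq_eq_of_L2]
    rcases le_or_gt 0 C with hC | hC
    · rw [← Real.sqrt_mul hC, Finset.univ_eq_attach]
      simp only [hΦ]
      rw [Finset.sum_attach s fun ζ => ‖amplify B ζ‖ ^ 2]
      exact Real.le_sqrt_of_sq_le (h B)
    · have h1 := h B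
      have h2 : 0 ≤ ∑ ζ ∈ s, ‖amplify B ζ‖ ^ 2 := Finset.sum_nonneg fun _ _ => by positivity
      have h3 : ‖τ B‖ ^ 2 ≤ 0 := h1.trans (mul_nonpos_of_nonpos_of_nonneg hC.le h2)
      have h4 : ‖τ B‖ = 0 := by nlinarith [norm_nonneg (τ B)]
      rw [h4]
      positivity
  have : τ = ∑ ζ : s, sigmaWeakLin (e ζ, ζ.1) := by
    refine LinearMap.ext fun B => ?_
    rw [he, PiLp.inner_apply, LinearMap.sum_apply]
    refine Finset.sum_congr rfl fun ζ _ => ?_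
    rw [hΦ]
    exact (sigmaWeakFunctional_eq_inner (e ζ, ζ.1) B).symm
  rw [this]
  exact Submodule.sum_mem _ fun ζ _ => Submodule.subset_span ⟨_, rfl⟩

/-- A completely positive map dominated by a normal one is normal. -/
theorem IsNormalMap.of_le {φ ψ : (X →L[ℂ] X) →ₗ[ℂ] (Y →L[ℂ] Y)} (hφ : IsNormalMap φ)
    (hψ : IsCP ψ) (h : IsCP (φ - ψ)) : IsNormalMap ψ := by
  rw [isNormalMap_iff] at hφ ⊢
  intro f g
  obtain ⟨s, C, hC, hb⟩ := exists_bound_of_mem_normalFunctionals (hφ g g)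
  -- By Kadison–Schwarz |(f, ψ(B)g)|² is at most a constant times (g, ψ(B*B)g), which is at most (g,
  -- φ(B*B)g). The last is controlled by normality of φ.
  refine mem_normalFunctionals_of_bound _ s (‖f‖ ^ 2 * (‖ψ 1‖ * C)) fun B => ?_
  have h1 : (⟪g, ψ (star B * B) g⟫_ℂ).re ≤ C * ∑ ζ ∈ s, ‖amplify B ζ‖ ^ 2 := by
    refine le_trans ?_ (hb B)
    refine le_trans ?_ (Complex.re_le_norm _)
    have h2 := (Complex.nonneg_iff.1 (inner_nonneg_of_nonneg
      (h.map_nonneg (star_mul_self_nonneg B)) g)).1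
    rw [LinearMap.sub_apply, _root_.sub_apply, inner_sub_right, Complex.sub_re] at h2
    change _ ≤ (⟪g, φ (star B * B) g⟫_ℂ).re
    linarith
  calc ‖⟪f, ψ B g⟫_ℂ‖ ^ 2 ≤ (‖f‖ * ‖ψ B g‖) ^ 2 := by
        gcongr; exact norm_inner_le_norm _ _
    _ = ‖f‖ ^ 2 * ‖ψ B g‖ ^ 2 := by ring
    _ ≤ ‖f‖ ^ 2 * (‖ψ 1‖ * (⟪g, ψ (star B * B) g⟫_ℂ).re) := by
        gcongr; exact hψ.schwarz B g
    _ ≤ ‖f‖ ^ 2 * (‖ψ 1‖ * (C * ∑ ζ ∈ s, ‖amplify B ζ‖ ^ 2)) := by gcongr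
    _ = _ := by ring

/-- Compressions by projections increasing to the identity converge σ-weakly. -/
theorem tendsto_of_mem_normalFunctionals {ι : Type*} {l : Filter ι} [l.IsCountablyGenerated]
    {P : ι → X →L[ℂ] X} (hs : ∀ t, star (P t) = P t) (hn : ∀ t, ‖P t‖ ≤ 1)
    (hP : ∀ x, Tendsto (fun t => P t x) l (𝓝 x)) {τ : (X →L[ℂ] X) →ₗ[ℂ] ℂ}
    (hτ : τ ∈ normalFunctionals X) (B : X →L[ℂ] X) :
    Tendsto (fun t => τ (sandwich (P t) B)) l (𝓝 (τ B)) := by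
  induction hτ using Submodule.span_induction with
  | mem τ h =>
    obtain ⟨⟨F, G⟩, rfl⟩ := h
    change Tendsto (fun t => ∑' k, ⟪F k, P t (B (P t (G k)))⟫_ℂ) l (𝓝 (∑' k, ⟪F k, B (G k)⟫_ℂ))
    have e : ∀ t x y, ⟪x, P t y⟫_ℂ = ⟪P t x, y⟫_ℂ := fun t x y => by
      conv_lhs => rw [← hs t]
      exact inner_apply_star _ _ _
    have hle : ∀ t x, ‖P t x‖ ≤ ‖x‖ := fun t x => by
      simpa using (P t).le_of_opNorm_le (hn t) x
    simp_rw [e]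
    refine tendsto_tsum_of_dominated_convergence
      (bound := fun k => ‖B‖ * (‖F k‖ ^ 2 + ‖G k‖ ^ 2)) ?_ ?_ ?_
    · exact ((lp_two_summable F).add (lp_two_summable G)).mul_left _
    · intro k
      exact (hP _).inner ((B.continuous.tendsto _).comp (hP _))
    · refine Eventually.of_forall fun t k => ?_
      calc _ ≤ ‖P t (F k)‖ * ‖B (P t (G k))‖ := norm_inner_le_norm _ _
        _ ≤ ‖F k‖ * (‖B‖ * ‖G k‖) := by
            gcongr
            · exact hle _ _
            · exact (B.le_opNorm _).trans (by gcongr; exact hle _ _)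
        _ ≤ ‖B‖ * (‖F k‖ ^ 2 + ‖G k‖ ^ 2) := by
            nlinarith [norm_nonneg B, mul_nonneg (norm_nonneg B) (sq_nonneg (‖F k‖ - ‖G k‖)),
              mul_nonneg (norm_nonneg B) (sq_nonneg ‖F k‖),
              mul_nonneg (norm_nonneg B) (sq_nonneg ‖G k‖)]
  | zero => exact tendsto_const_nhds
  | add τ σ _ _ h1 h2 => simpa using h1.add h2
  | smul c τ _ h => simpa using h.const_mul c

end Normal

theorem tendsto_of_tendsto_inner {ι : Type*} {l : Filter ι} {p : ℕ} {u : ι → BK p} {a : BK p}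
    (h : ∀ f g, Tendsto (fun t => ⟪f, u t g⟫_ℂ) l (𝓝 ⟪f, a g⟫_ℂ)) : Tendsto u l (𝓝 a) := by
  let b := EuclideanSpace.basisFun (Fin p) ℂ
  let Φ : BK p →ₗ[ℂ] (Fin p × Fin p → ℂ) := LinearMap.pi fun ij => matrixCoeff (b ij.1) (b ij.2)
  have hinj : Function.Injective Φ := by
    refine (injective_iff_map_eq_zero Φ).2 fun A hA => ?_
    have h1 : ∀ i j, ⟪b i, A (b j)⟫_ℂ = 0 := fun i j => congrFun hA (i, j)
    have h2 : (A : K p →ₗ[ℂ] K p) = 0 := b.toBasis.ext fun j => by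
      refine InnerProductSpace.ext_inner_left_basis b.toBasis fun i => ?_
      simpa using h1 i j
    ext1 x
    exact LinearMap.congr_fun h2 x
  have hemb : IsClosedEmbedding Φ :=
    LinearMap.isClosedEmbedding_of_injective (LinearMap.ker_eq_bot.2 hinj)
  rw [hemb.isInducing.tendsto_nhds_iff, tendsto_pi_nhds]
  exact fun ij => h _ _

end QWeight
end

noncomputable section
namespace QWeight

/-! ### Multiplication operators and the maps `A ↦ g ⊗ A` -/

section MulOp

variable {p : ℕ}

theorem ae_pos : ∀ᵐ x ∂halfLine, (0 : ℝ) < x := ae_restrict_mem measurableSet_Ioi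

theorem norm_mulOp_le {g : ℝ → ℂ} (hg : MemLp g ∞ halfLine) {C : ℝ} (hC : 0 ≤ C)
    (h : ∀ x, 0 < x → ‖g x‖ ≤ C) : ‖mulOp p g hg‖ ≤ C := by
  refine ContinuousLinearMap.opNorm_le_bound _ hC fun F => ?_
  refine Lp.norm_le_mul_norm_of_ae_le_mul ?_
  filter_upwards [mulOp_ae p g hg F, ae_pos] with x h1 h2
  rw [h1, norm_smul]
  gcongr
  exact h x h2

theorem star_mulOp {g : ℝ → ℂ} (hg : MemLp g ∞ halfLine)
    (h : ∀ x, 0 < x → star (g x) = g x) : star (mulOp p g hg) = mulOp p g hg := by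
  ext1 G
  refine ext_inner_left ℂ fun F => ?_
  rw [inner_apply_star, L2.inner_def, L2.inner_def]
  refine integral_congr_ae ?_
  filter_upwards [mulOp_ae p g hg F, mulOp_ae p g hg G, ae_pos] with x h1 h2 h3
  rw [h1, h2, inner_smul_left, inner_smul_right]
  exact congrArg (· * _) (h x h3)

theorem mulOp_sub {g h k : ℝ → ℂ} (hg : MemLp g ∞ halfLine) (hh : MemLp h ∞ halfLine)
    (hk : MemLp k ∞ halfLine) (e : ∀ x, 0 < x → g x - h x = k x) :
    mulOp p g hg - mulOp p h hh = mulOp p k hk := by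
  ext1 F
  apply Lp.ext
  rw [_root_.sub_apply]
  filter_upwards [mulOp_ae p g hg F, mulOp_ae p h hh F, mulOp_ae p k hk F, ae_pos,
    Lp.coeFn_sub (mulOp p g hg F) (mulOp p h hh F)] with x h1 h2 h3 h4 h5
  rw [h5, Pi.sub_apply, h1, h2, h3, ← e x h4, sub_smul]

/-- `1 ⊗ A` on `L²((0, ∞), K)`. -/
def ampLp (p : ℕ) (A : BK p) : BH p := A.compLpL 2 halfLine

theorem ampLp_ae (A : BK p) (F : H p) : ampLp p A F =ᵐ[halfLine] fun x => A (F x) :=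
  A.coeFn_compLpL F

theorem ampLp_mul (A B : BK p) : ampLp p (A * B) = ampLp p A * ampLp p B := by
  ext1 F
  apply Lp.ext
  filter_upwards [ampLp_ae (A * B) F, ampLp_ae B F, ampLp_ae A (ampLp p B F)] with x h1 h2 h3
  change _ = (ampLp p A (ampLp p B F)) x
  rw [h1, h3, h2]
  rfl

theorem star_ampLp (A : BK p) : star (ampLp p A) = ampLp p (star A) := by
  ext1 G
  refine ext_inner_left ℂ fun F => ?_
  rw [inner_apply_star, L2.inner_def, L2.inner_def]
  refine integral_congr_ae ?_
  filter_upwards [ampLp_ae A F, ampLp_ae (star A) G] with x h1 h2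
  rw [h1, h2, inner_apply_star]

theorem mulOp_comm_ampLp {g : ℝ → ℂ} (hg : MemLp g ∞ halfLine) (A : BK p) :
    mulOp p g hg * ampLp p A = ampLp p A * mulOp p g hg := by
  ext1 F
  apply Lp.ext
  filter_upwards [ampLp_ae A F, mulOp_ae p g hg (ampLp p A F), mulOp_ae p g hg F,
    ampLp_ae A (mulOp p g hg F)] with x h1 h2 h3 h4
  change (mulOp p g hg (ampLp p A F)) x = (ampLp p A (mulOp p g hg F)) x
  rw [h2, h1, h4, h3, map_smul]

/-- The map `A ↦ g ⊗ A`, so that `Λ(A) = mulLam expFun`. -/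
def mulLam (p : ℕ) (g : ℝ → ℂ) (hg : MemLp g ∞ halfLine) : BK p →ₗ[ℂ] BH p where
  toFun A := mulOp p g hg * ampLp p A
  map_add' A B := by rw [ampLp, ContinuousLinearMap.add_compLpL, mul_add]; rfl
  map_smul' c A := by
    rw [ampLp, ContinuousLinearMap.smul_compLpL, mul_smul_comm, RingHom.id_apply]; rfl

theorem Lam_eq : Lam p = mulLam p expFun memLp_expFun := rfl

theorem norm_mulLam_le {g : ℝ → ℂ} (hg : MemLp g ∞ halfLine) {C : ℝ} (hC : 0 ≤ C)
    (h : ∀ x, 0 < x → ‖g x‖ ≤ C) (A : BK p) : ‖mulLam p g hg A‖ ≤ C * ‖A‖ := by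
  refine (norm_mul_le _ _).trans ?_
  gcongr
  · exact norm_mulOp_le hg hC h
  · exact ContinuousLinearMap.norm_compLpL_le A

/-- With k real and k² = g, g ⊗ A*B factors as (k ⊗ A)*(k ⊗ B). -/
theorem isCP_mulLam {g k : ℝ → ℂ} (hg : MemLp g ∞ halfLine) (hk : MemLp k ∞ halfLine)
    (hs : ∀ x, 0 < x → star (k x) = k x) (h : ∀ x, 0 < x → k x * k x = g x) :
    IsCP (mulLam p g hg) := by
  refine isCP_of_conj _ (fun A => mulOp p k hk * ampLp p A) fun A B => ?_
  change mulOp p g hg * ampLp p (star A * B) = _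
  rw [star_mul, star_mulOp hk hs, star_ampLp, ← mulOp_mul p k k g hk hk hg h, ampLp_mul,
    mul_assoc, ← mul_assoc (mulOp p k hk) (ampLp p (star A)), mulOp_comm_ampLp]
  simp only [mul_assoc]
  rw [← mul_assoc (mulOp p k hk) (ampLp p (star A)), mulOp_comm_ampLp]
  simp only [mul_assoc]

end MulOp

/-! ### The projections E(t, ∞) and the pieces of Λ -/

section Cut

variable {p : ℕ}

theorem cutFun_mul (s t x : ℝ) : cutFun s x * cutFun t x = cutFun (max s t) x := by
  by_cases h1 : s ≤ x <;> by_cases h2 : t ≤ x <;> simp [cutFun, Set.indicator, h1, h2]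

theorem star_cutFun (t x : ℝ) : star (cutFun t x) = cutFun t x := by
  by_cases h : t ≤ x <;> simp [cutFun, Set.indicator, h]

theorem star_cutOp (t : ℝ) : star (cutOp p t) = cutOp p t :=
  star_mulOp _ fun x _ => star_cutFun t x

theorem cutOp_mul (s t : ℝ) : cutOp p s * cutOp p t = cutOp p (max s t) :=
  mulOp_mul p _ _ _ _ _ _ fun x _ => cutFun_mul s t x

theorem norm_cutOp_le (t : ℝ) : ‖cutOp p t‖ ≤ 1 :=
  norm_mulOp_le _ zero_le_one fun x _ => by
    by_cases h : t ≤ x <;> simp [cutFun, Set.indicator, h]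

theorem star_rootOp : star (rootOp p) = rootOp p :=
  star_mulOp _ fun x _ => by simp [rootFun]

theorem rootOp_comm_cutOp (t : ℝ) : rootOp p * cutOp p t = cutOp p t * rootOp p := by
  have hk : MemLp (fun x => rootFun x * cutFun t x) ∞ halfLine :=
    (memLp_cutFun t).mul memLp_rootFun
  rw [rootOp, cutOp, mulOp_mul p _ _ _ _ _ hk fun x _ => rfl,
    mulOp_mul p _ _ _ _ _ hk fun x _ => mul_comm _ _]

theorem cutMap_cutMap (s t : ℝ) (A : BH p) : cutMap p s (cutMap p t A) = cutMap p (max s t) A := by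
  change cutOp p s * (cutOp p t * A * cutOp p t) * cutOp p s = cutOp p _ * A * cutOp p _
  nth_rw 2 [max_comm]
  rw [← cutOp_mul, ← cutOp_mul]
  simp only [mul_assoc]

theorem isCP_cutMap (t : ℝ) : IsCP (cutMap p t) := isCP_sandwich (star_cutOp t)

theorem norm_cutMap_le (t : ℝ) (A : BH p) : ‖cutMap p t A‖ ≤ ‖A‖ := by
  calc ‖cutOp p t * A * cutOp p t‖ ≤ ‖cutOp p t‖ * ‖A‖ * ‖cutOp p t‖ :=
        (norm_mul_le _ _).trans (by gcongr; exact norm_mul_le _ _)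
    _ ≤ 1 * ‖A‖ * 1 := by gcongr <;> exact norm_cutOp_le t
    _ = ‖A‖ := by ring

theorem tendsto_cutOp (F : H p) : Tendsto (fun t => cutOp p t F) (𝓝[>] 0) (𝓝 F) := by
  rw [tendsto_iff_norm_sub_tendsto_zero]
  have h1 : ∀ t, ‖cutOp p t F - F‖ ^ 2 = ∫ x, ‖(cutFun t x - 1) • F x‖ ^ 2 ∂halfLine := fun t => by
    have h2 : ((‖cutOp p t F - F‖ ^ 2 : ℝ) : ℂ) =
        ((∫ x, ‖(cutFun t x - 1) • F x‖ ^ 2 ∂halfLine : ℝ) : ℂ) := by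
      rw [← integral_complex_ofReal]
      have := inner_self_eq_norm_sq_to_K (𝕜 := ℂ) (cutOp p t F - F)
      push_cast
      refine Eq.trans this.symm ?_
      rw [L2.inner_def]
      refine integral_congr_ae ?_
      filter_upwards [Lp.coeFn_sub (cutOp p t F) F, mulOp_ae p _ (memLp_cutFun t) F] with x h3 h4
      rw [inner_self_eq_norm_sq_to_K, h3, Pi.sub_apply, cutOp, h4, sub_smul, one_smul]
      rfl
    exact_mod_cast h2
  have h2 : Tendsto (fun t => ‖cutOp p t F - F‖ ^ 2) (𝓝[>] 0) (𝓝 0) := by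
    simp_rw [h1]
    have h0 : ∫ x, (0 : ℝ) ∂halfLine = 0 := integral_zero ℝ ℝ
    conv => rhs; rw [← h0]
    refine tendsto_integral_filter_of_dominated_convergence (fun x => ‖F x‖ ^ 2) ?_ ?_ ?_ ?_
    · refine Eventually.of_forall fun t => ?_
      refine AEStronglyMeasurable.pow (AEStronglyMeasurable.norm ?_) 2
      exact ((memLp_cutFun t).aestronglyMeasurable.sub aestronglyMeasurable_const).smul
        (Lp.aestronglyMeasurable F)
    · refine Eventually.of_forall fun t => Eventually.of_forall fun x => ?_
      rw [norm_smul, Real.norm_of_nonneg (by positivity), mul_pow]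
      refine mul_le_of_le_one_left (by positivity) ?_
      by_cases h : t ≤ x <;> simp [cutFun, Set.indicator, h]
    · exact (memLp_two_iff_integrable_sq_norm (Lp.aestronglyMeasurable F)).1 (Lp.memLp F)
    · filter_upwards [ae_pos] with x hx
      refine tendsto_const_nhds.congr' ?_
      filter_upwards [Ioo_mem_nhdsGT hx] with t ht
      simp [cutFun, Set.indicator, ht.2.le]
  have h3 := h2.sqrt
  simpa using h3

theorem IsNormalMap.tendsto_cutMap {φ : BH p →ₗ[ℂ] BK p} (hφ : IsNormalMap φ) (B : BH p) :
    Tendsto (fun t => φ (cutMap p t B)) (𝓝[>] 0) (𝓝 (φ B)) := by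
  rw [isNormalMap_iff] at hφ
  exact tendsto_of_tendsto_inner fun f g =>
    tendsto_of_mem_normalFunctionals star_cutOp norm_cutOp_le tendsto_cutOp (hφ f g) B

theorem norm_expFun_le_of_le {t x : ℝ} (h : t ≤ x) : ‖expFun x‖ ≤ Real.exp (-t) := by
  rw [expFun, Complex.norm_real, Real.norm_of_nonneg (Real.exp_pos _).le]
  exact Real.exp_le_exp.2 (neg_le_neg h)

/-- `A ↦ e^{-x} 1_{(0, s)} ⊗ A`, the part `Λ - E(s, ∞) Λ E(s, ∞)` of `Λ` below `s`. -/
def lowLam (p : ℕ) (s : ℝ) : BK p →ₗ[ℂ] BH p := Lam p - cutMap p s ∘ₗ Lam p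

theorem cutMap_mulLam (s : ℝ) {g k : ℝ → ℂ} (hg : MemLp g ∞ halfLine) (hk : MemLp k ∞ halfLine)
    (h : ∀ x, 0 < x → cutFun s x * g x = k x) (A : BK p) :
    cutMap p s (mulLam p g hg A) = mulLam p k hk A := by
  change mulOp p _ (memLp_cutFun s) * (mulOp p g hg * ampLp p A) * mulOp p _ (memLp_cutFun s) =
    mulOp p k hk * ampLp p A
  rw [mul_assoc, mul_assoc, ← mulOp_comm_ampLp, ← mul_assoc (mulOp p g hg),
    mulOp_mul p _ _ k hg (memLp_cutFun s) hk fun x hx => by rw [mul_comm, h x hx],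
    ← mul_assoc, mulOp_mul p _ _ k (memLp_cutFun s) hk hk fun x hx => by
      rw [← h x hx, ← mul_assoc, cutFun_mul, max_self]]

theorem memLp_one_sub_cutFun (s : ℝ) : MemLp (fun x => 1 - cutFun s x) ∞ halfLine :=
  (memLp_top_const 1).sub (memLp_cutFun s)

theorem memLp_lowFun (s : ℝ) : MemLp (fun x => (1 - cutFun s x) * expFun x) ∞ halfLine :=
  memLp_expFun.mul (memLp_one_sub_cutFun s)

theorem memLp_cutExp (s : ℝ) : MemLp (fun x => cutFun s x * expFun x) ∞ halfLine :=
  memLp_expFun.mul (memLp_cutFun s)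

theorem lowLam_eq (s : ℝ) : lowLam p s = mulLam p _ (memLp_lowFun s) := by
  ext1 A
  change Lam p A - cutMap p s (Lam p A) = _
  rw [Lam_eq, cutMap_mulLam s memLp_expFun (memLp_cutExp s) fun x _ => rfl]
  change mulOp p _ _ * _ - mulOp p _ _ * _ = mulOp p _ _ * _
  rw [← sub_mul, mulOp_sub]
  intro x _
  ring

/-- The function `x ↦ e^{-x/2}`. -/
def halfExpFun (x : ℝ) : ℂ := (Real.exp (-x / 2) : ℝ)

theorem memLp_halfExpFun : MemLp halfExpFun ∞ halfLine := by
  refine memLp_halfLine (by unfold halfExpFun; fun_prop) 1 fun x hx => ?_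
  rw [halfExpFun, Complex.norm_real, Real.norm_of_nonneg (Real.exp_pos _).le]
  exact Real.exp_le_one_iff.2 (by linarith)

theorem halfExpFun_mul (x : ℝ) : halfExpFun x * halfExpFun x = expFun x := by
  rw [halfExpFun, expFun, ← Complex.ofReal_mul, ← Real.exp_add]
  congr 3
  ring

theorem star_halfExpFun (x : ℝ) : star (halfExpFun x) = halfExpFun x := by
  exact Complex.conj_ofReal _

theorem isCP_Lam : IsCP (Lam p) := by
  rw [Lam_eq]
  exact isCP_mulLam _ memLp_halfExpFun (fun x _ => star_halfExpFun x) fun x _ => halfExpFun_mul x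

theorem isCP_lowLam (s : ℝ) : IsCP (lowLam p s) := by
  rw [lowLam_eq]
  have hk : MemLp (fun x => (1 - cutFun s x) * halfExpFun x) ∞ halfLine :=
    memLp_halfExpFun.mul (memLp_one_sub_cutFun s)
  refine isCP_mulLam _ hk (fun x _ => ?_) fun x _ => ?_
  · rw [star_mul', star_sub, star_one, star_cutFun, star_halfExpFun]
  · rw [← halfExpFun_mul]
    by_cases h : s ≤ x <;> simp [cutFun, Set.indicator, h]

theorem norm_Lam_le (A : BK p) : ‖Lam p A‖ ≤ ‖A‖ := by
  rw [Lam_eq]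
  simpa using norm_mulLam_le memLp_expFun zero_le_one
    (fun x hx => by simpa using norm_expFun_le_of_le hx.le) A

theorem norm_lowLam_le (s : ℝ) (A : BK p) : ‖lowLam p s A‖ ≤ ‖A‖ := by
  rw [lowLam_eq]
  refine (norm_mulLam_le (memLp_lowFun s) zero_le_one (fun x hx => ?_) A).trans (by simp)
  have := norm_expFun_le_of_le hx.le
  rw [neg_zero, Real.exp_zero] at this
  by_cases h : s ≤ x <;> simp [cutFun, Set.indicator, h, this]

/-- The factor e^{-t} < 1 makes the Neumann series for maps supported on [t, ∞) converge. -/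
theorem norm_cutMap_Lam_le (t : ℝ) (A : BK p) :
    ‖cutMap p t (Lam p A)‖ ≤ Real.exp (-t) * ‖A‖ := by
  rw [Lam_eq, cutMap_mulLam t _ (memLp_cutExp t) fun x _ => rfl]
  refine norm_mulLam_le _ (Real.exp_pos _).le (fun x _ => ?_) A
  by_cases h : t ≤ x
  · simpa [cutFun, Set.indicator, h] using norm_expFun_le_of_le h
  · simp [cutFun, Set.indicator, h, (Real.exp_pos _).le]

theorem norm_cutMap_lowLam_le (s t : ℝ) (A : BK p) :
    ‖cutMap p t (lowLam p s A)‖ ≤ Real.exp (-t) * ‖A‖ := by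
  rw [lowLam_eq, cutMap_mulLam t _ ((memLp_lowFun s).mul (memLp_cutFun t)) fun x _ => rfl]
  refine norm_mulLam_le _ (Real.exp_pos _).le (fun x _ => ?_) A
  by_cases h : t ≤ x
  · by_cases h' : s ≤ x
    · simp [cutFun, Set.indicator, h', (Real.exp_pos _).le]
    · simpa [cutFun, Set.indicator, h, h'] using norm_expFun_le_of_le h
  · simp [cutFun, Set.indicator, h, (Real.exp_pos _).le]

end Cut
end QWeight
end

noncomputable section
namespace QWeight

/-! ### The Choi–Effros product -/

section Star

variable {X : Type*} [NormedAddCommGroup X] [InnerProductSpace ℂ X] [CompleteSpace X]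

theorem clm_star_sub (A B : X →L[ℂ] X) : star (A - B) = star A - star B := star_sub A B

theorem clm_star_add (A B : X →L[ℂ] X) : star (A + B) = star A + star B := star_add A B

theorem clm_star_smul (c : ℂ) (A : X →L[ℂ] X) : star (c • A) = star c • star A := star_smul c A

end Star

section ChoiEffros

variable {p : ℕ} {L : BK p →ₗ[ℂ] BK p} {𝓛 : Submodule ℂ (BK p)}

theorem IsCP.star_mul_self_le {φ : BK p →ₗ[ℂ] BK p} (hφ : IsCP φ) (h : IsContractive φ)
    (A : BK p) : star (φ A) * φ A ≤ φ (star A * A) := by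
  rw [← sub_nonneg]
  have hpos := inner_nonneg_of_nonneg (hφ.map_nonneg (star_mul_self_nonneg A))
  refine isPositive_of_inner_nonneg _ fun f => ?_
  have h1 : ‖φ A f‖ ^ 2 ≤ (⟪f, φ (star A * A) f⟫_ℂ).re :=
    (hφ.schwarz A f).trans
      (mul_le_of_le_one_left (Complex.nonneg_iff.1 (hpos f)).1 h.norm_one_le)
  have h2 : ⟪f, (star (φ A) * φ A) f⟫_ℂ = ((‖φ A f‖ ^ 2 : ℝ) : ℂ) := by
    change ⟪f, star (φ A) (φ A f)⟫_ℂ = _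
    rw [inner_apply_star, inner_self_eq_norm_sq_to_K]
    push_cast
    rfl
  rw [_root_.sub_apply, inner_sub_right, h2, Complex.nonneg_iff, Complex.sub_re,
    Complex.sub_im, Complex.ofReal_re, Complex.ofReal_im, sub_zero]
  exact ⟨sub_nonneg.2 h1, (Complex.nonneg_iff.1 (hpos f)).2⟩

theorem eq_zero_of_forall_re_nonneg {a : ℝ} {w : ℂ}
    (h : ∀ c : ℂ, 0 ≤ a + (star c * w).re) : w = 0 := by
  by_contra hw
  -- At this c the expression equals a − (a + 1) = −1.
  have h1 := h (-(((a + 1) / ‖w‖ ^ 2 : ℝ) : ℂ) * w)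
  have h2 : star (-(((a + 1) / ‖w‖ ^ 2 : ℝ) : ℂ) * w) * w = ((-(a + 1) : ℝ) : ℂ) := by
    have h3 : star w * w = ((‖w‖ ^ 2 : ℝ) : ℂ) := by
      push_cast
      exact Complex.conj_mul' w
    have h4 : star (((a + 1) / ‖w‖ ^ 2 : ℝ) : ℂ) = (((a + 1) / ‖w‖ ^ 2 : ℝ) : ℂ) :=
      Complex.conj_ofReal _
    rw [star_mul', star_neg, h4, mul_assoc, h3, ← Complex.ofReal_neg, ← Complex.ofReal_mul]
    have : ‖w‖ ^ 2 ≠ 0 := by positivity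
    congr 1
    field_simp
  rw [h2, Complex.ofReal_re] at h1
  linarith

theorem IsCPIdempotentOnto.apply_of_mem (h : IsCPIdempotentOnto L 𝓛) {A : BK p} (hA : A ∈ 𝓛) :
    L A = A := by
  rw [← h.range_eq] at hA
  obtain ⟨B, rfl⟩ := hA
  exact h.idempotent B

theorem IsCPIdempotentOnto.apply_mem (h : IsCPIdempotentOnto L 𝓛) (A : BK p) : L A ∈ 𝓛 :=
  h.range_eq ▸ ⟨A, rfl⟩

theorem IsCPIdempotentOnto.star_mem (h : IsCPIdempotentOnto L 𝓛) {A : BK p} (hA : A ∈ 𝓛) :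
    star A ∈ 𝓛 := by
  rw [← h.apply_of_mem hA, ← h.cp.map_star]
  exact h.apply_mem _

/-- The Choi–Effros identity `L(X L(Y)) = L(X Y)` for `X` in the range of `L`. -/
theorem IsCPIdempotentOnto.apply_mul_apply (h : IsCPIdempotentOnto L 𝓛) {X : BK p} (hX : X ∈ 𝓛)
    (Y : BK p) : L (X * L Y) = L (X * Y) := by
  have hs := h.star_mem hX
  have hLs := h.apply_of_mem hs
  -- The form L(Z*Z) − L(L(Z)*L(Z)) is positive, and it vanishes at Z = X* because L fixes X*. A
  -- null vector of a positive form is orthogonal to everything, and the pairing of X* with Y is the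
  -- claimed identity.
  have key : ∀ Z, 0 ≤ L (star Z * Z) - L (star (L Z) * L Z) := fun Z => by
    have := h.cp.map_nonneg (sub_nonneg.2 (h.cp.star_mul_self_le h.contractive Z))
    rwa [map_sub, h.idempotent] at this
  rw [eq_comm, ← sub_eq_zero]
  set W := L (X * Y) - L (X * L Y) with hW
  -- The |c|² terms cancel, so the expression is affine in c and bounded below only if W vanishes.
  have hexp : ∀ c : ℂ, L (star (Y + c • star X) * (Y + c • star X)) -
      L (star (L (Y + c • star X)) * L (Y + c • star X)) =
      (L (star Y * Y) - L (star (L Y) * L Y)) + (star c • W + star (star c • W)) := fun c => by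
    have e1 : star W = L (star Y * star X) - L (star (L Y) * star X) := by
      rw [hW, clm_star_sub, ← h.cp.map_star, ← h.cp.map_star, star_mul, star_mul]
    rw [clm_star_smul, e1, hW]
    simp only [map_add, map_smul, hLs, clm_star_add, clm_star_smul, star_star, add_mul, mul_add,
      smul_mul_assoc, mul_smul_comm, smul_sub, smul_add]
    abel
  have h0 : ∀ f, ⟪f, W f⟫_ℂ = 0 := fun f => by
    refine eq_zero_of_forall_re_nonneg
      (a := (⟪f, (L (star Y * Y) - L (star (L Y) * L Y)) f⟫_ℂ).re / 2) fun c => ?_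
    have h1 := key (Y + c • star X)
    rw [hexp] at h1
    have h2 := (Complex.nonneg_iff.1 (inner_nonneg_of_nonneg h1 f)).1
    rw [_root_.add_apply, _root_.add_apply, inner_add_right, inner_add_right, inner_apply_star,
      ← inner_conj_symm ((star c • W) f) f, _root_.smul_apply, inner_smul_right, Complex.add_re,
      Complex.add_re, Complex.conj_re] at h2
    linarith
  have h3 : (W : K p →ₗ[ℂ] K p) = 0 := by
    refine inner_map_self_eq_zero _ |>.1 fun f => ?_
    exact inner_eq_zero_symm.1 (h0 f)
  ext1 x
  exact LinearMap.congr_fun h3 x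

theorem IsCPIdempotentOnto.apply_apply_mul (h : IsCPIdempotentOnto L 𝓛) {Y : BK p} (hY : Y ∈ 𝓛)
    (X : BK p) : L (L X * Y) = L (X * Y) := by
  have := congrArg star (h.apply_mul_apply (h.star_mem hY) (star X))
  rwa [← h.cp.map_star, ← h.cp.map_star, star_mul, star_mul, star_star, h.cp.map_star,
    star_star, star_star] at this

end ChoiEffros

/-! ### Boundary representations -/

section Rep

variable {p : ℕ} {ω η : WeightMap p}

theorem cutoff_apply {t : ℝ} (ht : 0 < t) (A : BH p) :
    cutoff ω t A = ω ⟨cutMap p t A, cutMap_mem ht A⟩ := by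
  rw [cutoff, dif_pos ht]
  rfl

theorem cutoff_cutMap {s t : ℝ} (ht : 0 < t) (h : t ≤ s) (A : BH p) :
    cutoff ω t (cutMap p s A) = cutoff ω s A := by
  rw [cutoff_apply ht, cutoff_apply (ht.trans_le h)]
  congr 2
  rw [cutMap_cutMap, max_eq_right h]

theorem cutoff_mem_range {t : ℝ} (ht : 0 < t) (A : BH p) :
    cutoff ω t A ∈ LinearMap.range ω := by
  rw [cutoff_apply ht]
  exact ⟨_, rfl⟩

theorem bdryRep_apply (t : ℝ) (A : BH p) :
    bdryRep ω t A = Ring.inverse (iotaAdd ω t) (cutoff ω t A) := rfl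

/-- Expressing the inverse through π_t itself removes it from all later identities. -/
theorem inverse_iotaAdd {t : ℝ} (h : IsUnit (iotaAdd ω t)) :
    Ring.inverse (iotaAdd ω t) = 1 - bdryRep ω t ∘ₗ Lam p := by
  have h1 : Ring.inverse (iotaAdd ω t) * (1 + cutoff ω t ∘ₗ Lam p) = 1 :=
    Ring.inverse_mul_cancel _ h
  rw [mul_add, mul_one] at h1
  exact eq_sub_of_add_eq (G := Module.End ℂ (BK p)) h1

theorem bdryRep_eq_sub {t : ℝ} (h : IsUnit (iotaAdd ω t)) (A : BH p) :
    bdryRep ω t A = cutoff ω t A - bdryRep ω t (Lam p (cutoff ω t A)) := by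
  rw [bdryRep_apply, inverse_iotaAdd h]
  rfl

theorem bdryRep_add_cutoff {t : ℝ} (h : IsUnit (iotaAdd ω t)) (A : BH p) :
    bdryRep ω t A + cutoff ω t (Lam p (bdryRep ω t A)) = cutoff ω t A := by
  have h1 : (iotaAdd ω t * Ring.inverse (iotaAdd ω t)) (cutoff ω t A) = cutoff ω t A := by
    rw [Ring.mul_inverse_cancel _ h, Module.End.one_apply]
  exact h1

theorem bdryRep_mem_range {t : ℝ} (ht : 0 < t) (h : IsUnit (iotaAdd ω t)) (A : BH p) :
    bdryRep ω t A ∈ LinearMap.range ω := by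
  rw [eq_sub_of_add_eq (bdryRep_add_cutoff h A)]
  exact sub_mem (cutoff_mem_range ht _) (cutoff_mem_range ht _)

theorem bdryRep_cutMap_self {t : ℝ} (ht : 0 < t) (A : BH p) :
    bdryRep ω t (cutMap p t A) = bdryRep ω t A := by
  rw [bdryRep_apply, cutoff_cutMap ht le_rfl, bdryRep_apply]

/-- Recognition of the boundary representation. -/
theorem isUnit_and_bdryRep_eq {t : ℝ} {ψ : BH p →ₗ[ℂ] BK p}
    (h1 : ∀ A, (A + cutoff ω t (Lam p A)) - ψ (Lam p (A + cutoff ω t (Lam p A))) = A)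
    (h2 : ∀ A, ψ A = cutoff ω t A - ψ (Lam p (cutoff ω t A))) :
    IsUnit (iotaAdd ω t) ∧ bdryRep ω t = ψ := by
  have e1 : (1 - ψ ∘ₗ Lam p : Module.End ℂ (BK p)) * iotaAdd ω t = 1 :=
    LinearMap.ext fun A => h1 A
  -- B(K) is finite dimensional, so a one-sided inverse is two-sided.
  have e2 : iotaAdd ω t * (1 - ψ ∘ₗ Lam p : Module.End ℂ (BK p)) = 1 :=
    mul_eq_one_comm.1 e1
  have hu : IsUnit (iotaAdd ω t) := ⟨⟨_, _, e2, e1⟩, rfl⟩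
  refine ⟨hu, LinearMap.ext fun A => ?_⟩
  have : Ring.inverse (iotaAdd ω t) = 1 - ψ ∘ₗ Lam p := by
    have := congrArg (Ring.inverse (iotaAdd ω t) * ·) e2
    simpa only [← mul_assoc, Ring.inverse_mul_cancel _ hu, one_mul, mul_one] using this.symm
  rw [bdryRep_apply, this, h2]
  rfl

theorem sandwich_rootOp_cutMap (t : ℝ) (B : BH p) :
    sandwich (rootOp p) (cutMap p t B) = cutMap p t (sandwich (rootOp p) B) := by
  change rootOp p * (cutOp p t * B * cutOp p t) * rootOp p =
    cutOp p t * (rootOp p * B * rootOp p) * cutOp p t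
  rw [← mul_assoc, ← mul_assoc, rootOp_comm_cutOp]
  simp only [mul_assoc]
  rw [rootOp_comm_cutOp]

theorem cutoff_sandwich {t : ℝ} (ht : 0 < t) (B : BH p) :
    cutoff ω t (sandwich (rootOp p) B) = ω (toBdryAlg p (cutMap p t B)) := by
  rw [cutoff_apply ht]
  congr 1
  exact Subtype.ext (sandwich_rootOp_cutMap t B).symm

theorem IsBoundaryWeightMap.tendsto_cutoff (h : IsBoundaryWeightMap ω) (B : BH p) :
    Tendsto (fun t => cutoff ω t (sandwich (rootOp p) B)) (𝓝[>] 0) (𝓝 (ω (toBdryAlg p B))) := by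
  refine (IsNormalMap.tendsto_cutMap h B).congr' ?_
  filter_upwards [self_mem_nhdsWithin] with t ht
  exact (cutoff_sandwich ht B).symm

theorem exists_toBdryAlg_eq (X : bdryAlg p) : ∃ B, toBdryAlg p B = X :=
  (sandwich (rootOp p)).surjective_rangeRestrict X

/-- By normality each value of ω is a limit of values of its cut-offs, and subspaces of B(K) are
closed. -/
theorem IsBoundaryWeightMap.range_le (h : IsBoundaryWeightMap ω) {S : Submodule ℂ (BK p)}
    (hS : ∀ t, 0 < t → ∀ A, cutoff ω t A ∈ S) : LinearMap.range ω ≤ S := by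
  rintro _ ⟨X, rfl⟩
  obtain ⟨B, rfl⟩ := exists_toBdryAlg_eq X
  refine (Submodule.closed_of_finiteDimensional S).mem_of_tendsto (h.tendsto_cutoff B) ?_
  filter_upwards [self_mem_nhdsWithin] with t ht
  exact hS t ht _

theorem IsBoundaryWeightMap.eq_zero (h : IsBoundaryWeightMap ω)
    (hω : ∀ t, 0 < t → ∀ A, cutoff ω t A = 0) : ω = 0 := by
  refine LinearMap.range_eq_bot.1 (le_bot_iff.1 (h.range_le fun t ht A => ?_))
  rw [hω t ht]
  exact zero_mem _

/-- Fixing an ultrafilter realising L lets the later limits, those defining η included, be taken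
along the same one. -/
theorem isLimitPoint_iff {L : BK p →ₗ[ℂ] BK p} : IsLimitPoint ω L ↔
    ∃ U : Ultrafilter ℝ, (U : Filter ℝ) ≤ 𝓝[>] 0 ∧
      ∀ A, Tendsto (fun t => bdryRep ω t (Lam p A)) U (𝓝 (L A)) := by
  rw [IsLimitPoint, mapClusterPt_iff_ultrafilter]
  simp only [tendsto_pi_nhds]

theorem IsQWeightMap.exists_isLimitPoint (hω : IsQWeightMap ω) : ∃ L, IsLimitPoint ω L := by
  obtain ⟨L, hL⟩ := exists_pointwise_limit (Ultrafilter.of (𝓝[>] (0 : ℝ)))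
    (fun t => bdryRep ω t ∘ₗ Lam p) fun A => ⟨‖A‖, by
      filter_upwards [Ultrafilter.of_le _ self_mem_nhdsWithin] with t ht
      exact (hω.rep_contractive t ht _).trans (norm_Lam_le A)⟩
  exact ⟨L, isLimitPoint_iff.2 ⟨_, Ultrafilter.of_le _, hL⟩⟩

theorem IsQWeightMap.isCPIdempotentOnto (hω : IsQWeightMap ω) (h0 : IsIndexZero ω)
    {L : BK p →ₗ[ℂ] BK p} (hL : IsLimitPoint ω L) : IsCPIdempotentOnto L (LinearMap.range ω) := by
  obtain ⟨U, hU, hL⟩ := isLimitPoint_iff.1 hL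
  have hpos : ∀ᶠ t in U, (0 : ℝ) < t := hU self_mem_nhdsWithin
  -- This is where index zero enters: π_t(E(s,∞)AE(s,∞)) = ω_s(A) − π_tΛω_s(A) tends to 0, while the
  -- right side tends to ω_s(A) − L(ω_s(A)).
  have hfix : ∀ A ∈ LinearMap.range ω, L A = A := by
    suffices h : LinearMap.range ω ≤ LinearMap.eqLocus L LinearMap.id from fun A hA => h hA
    refine hω.boundaryWeight.range_le fun s hs A => ?_
    have h1 : Tendsto (fun t => bdryRep ω t (cutMap p s A)) U (𝓝 0) :=
      (h0.tendsto s hs A).mono_left hU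
    have h2 : Tendsto (fun t => cutoff ω s A - bdryRep ω t (Lam p (cutoff ω s A))) U (𝓝 0) := by
      refine h1.congr' ?_
      filter_upwards [hpos, hU (Ioo_mem_nhdsGT hs)] with t ht hts
      rw [bdryRep_eq_sub (hω.invertible t ht), cutoff_cutMap ht hts.2.le]
    have h3 := tendsto_nhds_unique h2 (tendsto_const_nhds.sub (hL _))
    exact (sub_eq_zero.1 h3.symm).symm
  have hmem : ∀ A, L A ∈ LinearMap.range ω := fun A => by
    refine (Submodule.closed_of_finiteDimensional (LinearMap.range ω)).mem_of_tendsto (hL A) ?_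
    filter_upwards [hpos] with t ht
    exact bdryRep_mem_range ht (hω.invertible t ht) _
  refine ⟨?_, fun A => ?_, fun A => hfix _ (hmem A), ?_⟩
  · refine IsCP.of_tendsto (T := fun t => bdryRep ω t ∘ₗ Lam p) hL ?_
    filter_upwards [hpos] with t ht
    exact (hω.rep_cp t ht).comp isCP_Lam
  · refine le_of_tendsto (hL A).norm ?_
    filter_upwards [hpos] with t ht
    exact (hω.rep_contractive t ht _).trans (norm_Lam_le A)
  · exact le_antisymm (by rintro _ ⟨A, rfl⟩; exact hmem A) fun A hA => ⟨A, hfix A hA⟩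

end Rep
end QWeight
end

noncomputable section
namespace QWeight

variable {p : ℕ}

/-! ### Completely positive contractions supported on `[t, ∞)` -/

/-- `φ` is a completely positive contraction with `φ(E(t, ∞) A E(t, ∞)) = φ(A)`. -/
structure IsLocalRep (t : ℝ) (φ : BH p →ₗ[ℂ] BK p) : Prop where
  pos : 0 < t
  cp : IsCP φ
  contractive : IsContractive φ
  cut : ∀ A, φ (cutMap p t A) = φ A

/-- The bounded weight map `(1 - φΛ)⁻¹ φ`. -/
def toWeight (φ : BH p →ₗ[ℂ] BK p) : BH p →ₗ[ℂ] BK p :=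
  Ring.inverse (1 - φ ∘ₗ Lam p : Module.End ℂ (BK p)) ∘ₗ φ

/-- The boundary representation at `s` of the weight map `toWeight φ`. -/
def stopped (φ : BH p →ₗ[ℂ] BK p) (s : ℝ) : BH p →ₗ[ℂ] BK p :=
  Ring.inverse (1 - φ ∘ₗ lowLam p s : Module.End ℂ (BK p)) ∘ₗ φ ∘ₗ cutMap p s

/-- With G and G₁ the two inverses, the resolvent identity G = G₁ + G(φ − φ₁)YG₁ gives Gφ − G₁φ₁ =
G(φ − φ₁) + G(φ − φ₁)YG₁φ₁, a sum of compositions of completely positive maps. -/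
theorem IsCP.resolvent_sub {φ φ₁ : BH p →ₗ[ℂ] BK p} {Y : BK p →ₗ[ℂ] BH p} (hY : IsCP Y)
    (hφ₁ : IsCP φ₁) (h : IsCP (φ - φ₁))
    (hu : IsUnit (1 - φ ∘ₗ Y : Module.End ℂ (BK p)))
    (hu₁ : IsUnit (1 - φ₁ ∘ₗ Y : Module.End ℂ (BK p)))
    (hG : IsCP (Ring.inverse (1 - φ ∘ₗ Y : Module.End ℂ (BK p)) : Module.End ℂ (BK p)))
    (hG₁ : IsCP (Ring.inverse (1 - φ₁ ∘ₗ Y : Module.End ℂ (BK p)) : Module.End ℂ (BK p))) :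
    IsCP (Ring.inverse (1 - φ ∘ₗ Y : Module.End ℂ (BK p)) ∘ₗ φ -
      Ring.inverse (1 - φ₁ ∘ₗ Y : Module.End ℂ (BK p)) ∘ₗ φ₁) := by
  set G : Module.End ℂ (BK p) := Ring.inverse (1 - φ ∘ₗ Y : Module.End ℂ (BK p))
  set G₁ : Module.End ℂ (BK p) := Ring.inverse (1 - φ₁ ∘ₗ Y : Module.End ℂ (BK p))
  have h1 : G * (1 - φ ∘ₗ Y : Module.End ℂ (BK p)) = 1 := Ring.inverse_mul_cancel _ hu
  have h2 : (1 - φ₁ ∘ₗ Y : Module.End ℂ (BK p)) * G₁ = 1 := Ring.mul_inverse_cancel _ hu₁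
  have h3 : ∀ A, G A = G₁ A + G ((φ - φ₁) (Y (G₁ A))) := fun A => by
    have e1 := LinearMap.congr_fun h1 (G₁ A)
    have e2 := LinearMap.congr_fun h2 A
    simp only [Module.End.mul_apply, LinearMap.sub_apply, Module.End.one_apply,
      LinearMap.comp_apply] at e1 e2 ⊢
    rw [map_sub] at e1 ⊢
    have e3 : G A = G (G₁ A) - G (φ₁ (Y (G₁ A))) := by rw [← map_sub, e2]
    rw [e3, sub_eq_iff_eq_add.1 e1]
    abel
  refine ((hG.comp h).add (hG.comp (h.comp (hY.comp (hG₁.comp hφ₁))))).congr fun A => ?_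
  have := h3 (φ₁ A)
  simp only [LinearMap.add_apply, LinearMap.sub_apply, LinearMap.comp_apply, map_sub] at this ⊢
  rw [this]
  abel

namespace IsLocalRep

variable {t : ℝ} {φ φ₁ : BH p →ₗ[ℂ] BK p}

theorem exp_lt_one (h : IsLocalRep t φ) : Real.exp (-t) < 1 :=
  Real.exp_lt_one_iff.2 (neg_lt_zero.2 h.pos)

theorem norm_comp_Lam_le (h : IsLocalRep t φ) (A : BK p) :
    ‖(φ ∘ₗ Lam p) A‖ ≤ Real.exp (-t) * ‖A‖ := by
  rw [LinearMap.comp_apply, ← h.cut]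
  exact (h.contractive _).trans (norm_cutMap_Lam_le t A)

theorem norm_comp_lowLam_le (h : IsLocalRep t φ) (s : ℝ) (A : BK p) :
    ‖(φ ∘ₗ lowLam p s) A‖ ≤ Real.exp (-t) * ‖A‖ := by
  rw [LinearMap.comp_apply, ← h.cut]
  exact (h.contractive _).trans (norm_cutMap_lowLam_le s t A)

theorem isUnit_Lam (h : IsLocalRep t φ) : IsUnit (1 - φ ∘ₗ Lam p : Module.End ℂ (BK p)) :=
  isUnit_one_sub_of_norm_le h.exp_lt_one h.norm_comp_Lam_le

theorem isUnit_lowLam (h : IsLocalRep t φ) (s : ℝ) :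
    IsUnit (1 - φ ∘ₗ lowLam p s : Module.End ℂ (BK p)) :=
  isUnit_one_sub_of_norm_le h.exp_lt_one (h.norm_comp_lowLam_le s)

theorem isCP_inverse_Lam (h : IsLocalRep t φ) :
    IsCP (Ring.inverse (1 - φ ∘ₗ Lam p : Module.End ℂ (BK p)) : Module.End ℂ (BK p)) :=
  IsCP.neumann (h.cp.comp isCP_Lam) (Real.exp_pos _).le h.exp_lt_one h.norm_comp_Lam_le

theorem isCP_inverse_lowLam (h : IsLocalRep t φ) (s : ℝ) :
    IsCP (Ring.inverse (1 - φ ∘ₗ lowLam p s : Module.End ℂ (BK p)) : Module.End ℂ (BK p)) :=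
  IsCP.neumann (h.cp.comp (isCP_lowLam s)) (Real.exp_pos _).le h.exp_lt_one
    (h.norm_comp_lowLam_le s)

theorem isCP_toWeight (h : IsLocalRep t φ) : IsCP (toWeight φ) := h.isCP_inverse_Lam.comp h.cp

theorem isCP_stopped (h : IsLocalRep t φ) (s : ℝ) : IsCP (stopped φ s) :=
  (h.isCP_inverse_lowLam s).comp (h.cp.comp (isCP_cutMap s))

theorem isCP_toWeight_sub (h : IsLocalRep t φ) (h₁ : IsLocalRep t φ₁) (hle : IsCP (φ - φ₁)) :
    IsCP (toWeight φ - toWeight φ₁) :=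
  isCP_Lam.resolvent_sub h₁.cp hle h.isUnit_Lam h₁.isUnit_Lam h.isCP_inverse_Lam
    h₁.isCP_inverse_Lam

theorem isCP_stopped_sub (h : IsLocalRep t φ) (h₁ : IsLocalRep t φ₁) (hle : IsCP (φ - φ₁))
    (s : ℝ) : IsCP (stopped φ s - stopped φ₁ s) :=
  ((isCP_lowLam s).resolvent_sub h₁.cp hle (h.isUnit_lowLam s) (h₁.isUnit_lowLam s)
    (h.isCP_inverse_lowLam s) (h₁.isCP_inverse_lowLam s)).comp (isCP_cutMap s)

theorem toWeight_eq (h : IsLocalRep t φ) (A : BH p) :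
    toWeight φ A = φ A + φ (Lam p (toWeight φ A)) := by
  have := LinearMap.congr_fun (Ring.mul_inverse_cancel _ h.isUnit_Lam) (φ A)
  exact eq_add_of_sub_eq this

theorem eq_toWeight (h : IsLocalRep t φ) {A : BH p} {B : BK p} (hB : B - φ (Lam p B) = φ A) :
    B = toWeight φ A := by
  have := LinearMap.congr_fun (Ring.inverse_mul_cancel _ h.isUnit_Lam) B
  rw [toWeight, LinearMap.comp_apply, ← hB]
  exact this.symm

theorem stopped_eq (h : IsLocalRep t φ) (s : ℝ) (A : BH p) :
    stopped φ s A = φ (cutMap p s A) + φ (lowLam p s (stopped φ s A)) := by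
  have := LinearMap.congr_fun (Ring.mul_inverse_cancel _ (h.isUnit_lowLam s)) (φ (cutMap p s A))
  exact eq_add_of_sub_eq this

theorem inverse_lowLam_apply (h : IsLocalRep t φ) (s : ℝ) (A : BK p) :
    Ring.inverse (1 - φ ∘ₗ lowLam p s : Module.End ℂ (BK p)) (A - φ (lowLam p s A)) = A :=
  LinearMap.congr_fun (Ring.inverse_mul_cancel _ (h.isUnit_lowLam s)) A

/-- `1 - stopped φ s Λ = (1 - φ Λ_s)⁻¹ (1 - φ Λ)`. -/
theorem sub_stopped_Lam (h : IsLocalRep t φ) (s : ℝ) (A : BK p) :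
    A - stopped φ s (Lam p A) =
      Ring.inverse (1 - φ ∘ₗ lowLam p s : Module.End ℂ (BK p)) (A - φ (Lam p A)) := by
  have h1 : A - φ (Lam p A) = (A - φ (lowLam p s A)) - φ (cutMap p s (Lam p A)) := by
    simp only [lowLam, LinearMap.sub_apply, LinearMap.comp_apply, map_sub]
    abel
  rw [h1, map_sub, h.inverse_lowLam_apply]
  rfl

/-- With `stopped_eq_sub` this verifies the two hypotheses of `isUnit_and_bdryRep_eq` for the weight
B ↦ `toWeight φ B`. -/
theorem stopped_resolvent (h : IsLocalRep t φ) (s : ℝ) (A : BK p) :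
    (A + toWeight φ (cutMap p s (Lam p A))) -
      stopped φ s (Lam p (A + toWeight φ (cutMap p s (Lam p A)))) = A := by
  rw [h.sub_stopped_Lam]
  set B := toWeight φ (cutMap p s (Lam p A)) with hB
  have h1 := h.toWeight_eq (cutMap p s (Lam p A))
  rw [← hB] at h1
  have h2 : A + B - φ (Lam p (A + B)) = A - φ (lowLam p s A) := by
    simp only [lowLam, LinearMap.sub_apply, LinearMap.comp_apply, map_sub, map_add]
    nth_rw 1 [h1]
    abel
  rw [h2, h.inverse_lowLam_apply]

theorem stopped_eq_sub (h : IsLocalRep t φ) (s : ℝ) (A : BH p) :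
    stopped φ s A = toWeight φ (cutMap p s A) - stopped φ s (Lam p (toWeight φ (cutMap p s A))) := by
  rw [h.sub_stopped_Lam]
  have h1 := h.toWeight_eq (cutMap p s A)
  rw [← sub_eq_iff_eq_add] at h1
  rw [h1]
  rfl

end IsLocalRep

section Rep

variable {ω : WeightMap p} {t : ℝ}

theorem IsQWeightMap.isLocalRep (hω : IsQWeightMap ω) (ht : 0 < t) :
    IsLocalRep t (bdryRep ω t) :=
  ⟨ht, hω.rep_cp t ht, hω.rep_contractive t ht, bdryRep_cutMap_self ht⟩

theorem IsQWeightMap.toWeight_bdryRep (hω : IsQWeightMap ω) (ht : 0 < t) (A : BH p) :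
    toWeight (bdryRep ω t) A = cutoff ω t A :=
  ((hω.isLocalRep ht).eq_toWeight (bdryRep_eq_sub (hω.invertible t ht) A).symm).symm

/-- The boundary representation at t determines those at all s ≥ t, so π_s can be compared with the
stopped version of a smaller map. -/
theorem IsQWeightMap.stopped_bdryRep (hω : IsQWeightMap ω) (ht : 0 < t) {s : ℝ} (h : t ≤ s) :
    stopped (bdryRep ω t) s = bdryRep ω s := by
  have e : ∀ A, cutoff ω s A = toWeight (bdryRep ω t) (cutMap p s A) := fun A => by
    rw [hω.toWeight_bdryRep ht, cutoff_cutMap ht h]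
  refine (isUnit_and_bdryRep_eq (fun A => ?_) fun A => ?_).2.symm
  · rw [e]
    exact (hω.isLocalRep ht).stopped_resolvent s A
  · rw [e]
    exact (hω.isLocalRep ht).stopped_eq_sub s A

theorem IsCPWeightMap.isCP_comp_toBdryAlg (h : IsCPWeightMap ω) : IsCP (ω ∘ₗ toBdryAlg p) := by
  intro n A f
  have e : ∀ i j, star (A i * rootOp p) * (A j * rootOp p) =
      sandwich (rootOp p) (star (A i) * A j) := fun i j => by
    rw [star_mul, star_rootOp]
    simp only [sandwich, LinearMap.coe_mk, AddHom.coe_mk, mul_assoc]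
  have := h n (fun i => A i * rootOp p) (fun i j => by rw [e]; exact ⟨_, rfl⟩) f
  simp only [e] at this
  exact this

/-- The bound does not depend on t; this keeps the approximating weights bounded as t → 0+. -/
theorem IsQWeightMap.norm_cutoff_sandwich_one_le (hω : IsQWeightMap ω) (ht : 0 < t) :
    ‖cutoff ω t (sandwich (rootOp p) 1)‖ ≤ ‖(ω ∘ₗ toBdryAlg p) 1‖ := by
  rw [cutoff_sandwich ht]
  refine (hω.cp.isCP_comp_toBdryAlg.norm_le _).trans (mul_le_of_le_one_right (norm_nonneg _) ?_)
  exact (norm_cutMap_le t 1).trans ContinuousLinearMap.norm_id_le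

end Rep

/-! ### Subordinates from complementary corners -/

/-- A pair of complementary completely positive corner maps of the range of `ω`. -/
structure IsCornerPair (ω : WeightMap p) (L Θ Θ' : BK p →ₗ[ℂ] BK p) : Prop where
  cp : IsCP Θ
  cp' : IsCP Θ'
  mem : ∀ A, Θ A ∈ LinearMap.range ω
  add : ∀ A ∈ LinearMap.range ω, Θ A + Θ' A = A
  idem : ∀ A, Θ (Θ A) = Θ A
  idem' : ∀ A, Θ' (Θ' A) = Θ' A
  kill : ∀ A, Θ' (Θ A) = 0
  one : Θ 1 + Θ' 1 = L 1

namespace IsCornerPair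

variable {ω : WeightMap p} {L Θ Θ' : BK p →ₗ[ℂ] BK p} {t : ℝ}

/-- The values of π_t lie in the range of ω, where Θ + Θ' is the identity, so the difference is
Θ'π_t. -/
theorem isCP_sub (h : IsCornerPair ω L Θ Θ') (hω : IsQWeightMap ω) (ht : 0 < t) :
    IsCP (bdryRep ω t - Θ ∘ₗ bdryRep ω t) :=
  (h.cp'.comp (hω.rep_cp t ht)).congr fun A => by
    have := h.add _ (bdryRep_mem_range ht (hω.invertible t ht) A)
    exact eq_sub_of_add_eq' this

theorem isLocalRep (h : IsCornerPair ω L Θ Θ') (hω : IsQWeightMap ω) (ht : 0 < t) :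
    IsLocalRep t (Θ ∘ₗ bdryRep ω t) where
  pos := ht
  cp := h.cp.comp (hω.rep_cp t ht)
  contractive := (hω.rep_contractive t ht).of_le (h.cp.comp (hω.rep_cp t ht)) (h.isCP_sub hω ht)
  cut A := congrArg Θ (bdryRep_cutMap_self ht A)

theorem isCP_bdryRep_sub_stopped (h : IsCornerPair ω L Θ Θ') (hω : IsQWeightMap ω) (ht : 0 < t)
    {s : ℝ} (hs : t ≤ s) : IsCP (bdryRep ω s - stopped (Θ ∘ₗ bdryRep ω t) s) := by
  rw [← hω.stopped_bdryRep ht hs]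
  exact (hω.isLocalRep ht).isCP_stopped_sub (h.isLocalRep hω ht) (h.isCP_sub hω ht) s

theorem isCP_cutoff_sub_toWeight (h : IsCornerPair ω L Θ Θ') (hω : IsQWeightMap ω) (ht : 0 < t) :
    IsCP (cutoff ω t - toWeight (Θ ∘ₗ bdryRep ω t)) := by
  have := (hω.isLocalRep ht).isCP_toWeight_sub (h.isLocalRep hω ht) (h.isCP_sub hω ht)
  exact this.congr fun A => by
    rw [LinearMap.sub_apply, LinearMap.sub_apply, hω.toWeight_bdryRep ht]

theorem norm_toWeight_sandwich_le (h : IsCornerPair ω L Θ Θ') (hω : IsQWeightMap ω) (ht : 0 < t)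
    (B : BH p) : ‖toWeight (Θ ∘ₗ bdryRep ω t) (sandwich (rootOp p) B)‖ ≤
      ‖(ω ∘ₗ toBdryAlg p) 1‖ * ‖B‖ := by
  have h1 : IsCP (toWeight (Θ ∘ₗ bdryRep ω t) ∘ₗ sandwich (rootOp p)) :=
    (h.isLocalRep hω ht).isCP_toWeight.comp (isCP_sandwich star_rootOp)
  have h2 : IsCP (cutoff ω t ∘ₗ sandwich (rootOp p) -
      toWeight (Θ ∘ₗ bdryRep ω t) ∘ₗ sandwich (rootOp p)) :=
    (h.isCP_cutoff_sub_toWeight hω ht).comp (isCP_sandwich star_rootOp)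
  refine (h1.norm_le B).trans ?_
  gcongr
  exact (h1.norm_one_le_of_le h2).trans (hω.norm_cutoff_sandwich_one_le ht)

theorem toWeight_mem (h : IsCornerPair ω L Θ Θ') (hω : IsQWeightMap ω) (ht : 0 < t) (A : BH p) :
    toWeight (Θ ∘ₗ bdryRep ω t) A ∈ LinearMap.range Θ := by
  rw [(h.isLocalRep hω ht).toWeight_eq]
  exact add_mem ⟨_, rfl⟩ ⟨_, rfl⟩

/-- Excursions out of the corner contribute little: `Θ π_s Λ - ψ_s Λ` is controlled by
`Θ' π_s Λ`. -/
theorem norm_sub_stopped_le (h : IsCornerPair ω L Θ Θ') (hω : IsQWeightMap ω)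
    (hL : IsCPIdempotentOnto L (LinearMap.range ω)) (ht : 0 < t) {s : ℝ} (hs : t ≤ s)
    (A : BH p) :
    ‖Θ (bdryRep ω s A) - stopped (Θ ∘ₗ bdryRep ω t) s A‖ ≤ ‖Θ' (bdryRep ω s A)‖ := by
  have hl := h.isLocalRep hω ht
  set φ := Θ ∘ₗ bdryRep ω t with hφ
  set G : Module.End ℂ (BK p) := Ring.inverse (1 - φ ∘ₗ lowLam p s : Module.End ℂ (BK p)) with hG
  -- The error turns out to be T applied to Θ'π_s(A). The final Θ' in T changes nothing there, as Θ'
  -- is idempotent, but it makes T(I) small enough for T to be contractive.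
  let T : BK p →ₗ[ℂ] BK p := G ∘ₗ φ ∘ₗ lowLam p s ∘ₗ Θ'
  have hGcp : IsCP G := hl.isCP_inverse_lowLam s
  have hTcp : IsCP T := hGcp.comp (hl.cp.comp ((isCP_lowLam s).comp h.cp'))
  have he : ‖L 1‖ ≤ 1 := hL.contractive.norm_one_le
  have hQ0 : 0 ≤ Θ 1 := h.cp.map_nonneg zero_le_one
  have hQ : ‖Θ 1‖ ≤ 1 := by
    refine (CStarAlgebra.norm_le_norm_of_nonneg_of_le hQ0 ?_).trans he
    rw [← h.one]
    exact le_add_of_nonneg_right (h.cp'.map_nonneg zero_le_one)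
  -- Here φ = Θπ_t, and π_t(lowLam(L(I))) is a positive contraction, hence at most I.
  have hpe : φ (lowLam p s (L 1)) ≤ Θ 1 := by
    refine h.cp.map_le_map ?_
    have h1 : IsCP (bdryRep ω t ∘ₗ lowLam p s ∘ₗ L) :=
      (hω.rep_cp t ht).comp ((isCP_lowLam s).comp hL.cp)
    have h2 : ‖bdryRep ω t (lowLam p s (L 1))‖ ≤ 1 :=
      (hω.rep_contractive t ht _).trans ((norm_lowLam_le s _).trans he)
    have h3 : 0 ≤ bdryRep ω t (lowLam p s (L 1)) := h1.map_nonneg zero_le_one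
    exact (CStarAlgebra.norm_le_one_iff_of_nonneg _ h3).1 h2
  -- Write Λ_s for `lowLam p s`. Splitting L(I) = Θ(I) + Θ'(I) in the last inequality gives
  -- φΛ_sΘ'(I) ≤ (ι − φΛ_s)Θ(I). The positive map G cancels the factor on the right.
  have hT1 : T 1 ≤ Θ 1 := by
    have h1 := hGcp.map_nonneg (sub_nonneg.2 hpe)
    rw [← h.one, map_add, map_add, ← sub_sub, map_sub, hl.inverse_lowLam_apply, sub_nonneg] at h1
    exact h1
  have hT : IsContractive T := hTcp.isContractive
    ((CStarAlgebra.norm_le_norm_of_nonneg_of_le (hTcp.map_nonneg zero_le_one) hT1).trans hQ)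
  have key : Θ (bdryRep ω s A) - stopped φ s A = T (Θ' (bdryRep ω s A)) := by
    set B := bdryRep ω s A with hB
    have hBmem : B ∈ LinearMap.range ω :=
      bdryRep_mem_range (ht.trans_le hs) (hω.invertible s (ht.trans_le hs)) A
    have h1 := (hω.isLocalRep ht).stopped_eq s A
    rw [hω.stopped_bdryRep ht hs, ← hB] at h1
    -- Apply Θ to π_s = π_t(E(s,∞)·E(s,∞)) + π_tΛ_sπ_s. Splitting B = ΘB + Θ'B then shows that ΘB
    -- solves the equation of the stopped map up to the source term φΛ_sΘ'B.
    have h2 : Θ B = φ (cutMap p s A) + φ (lowLam p s B) := by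
      nth_rw 1 [h1]
      rw [map_add]
      rfl
    have h3 : Θ B - φ (lowLam p s (Θ B)) = φ (cutMap p s A) + φ (lowLam p s (Θ' B)) := by
      nth_rw 1 [h2]
      nth_rw 1 [← h.add B hBmem]
      rw [map_add, map_add]
      abel
    have h4 := hl.inverse_lowLam_apply s (Θ B)
    rw [h3, map_add] at h4
    change _ = G (φ (lowLam p s (Θ' (Θ' B))))
    rw [h.idem', ← h4, add_comm]
    exact add_sub_cancel_right _ _
  rw [key]
  exact hT _

end IsCornerPair
end QWeight
end

/-! ### Limits of the corner weights as t → 0+ -/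

noncomputable section
namespace QWeight

variable {p : ℕ}

/-- Uniform contractivity allows the argument to vary with t, although T t converges only pointwise.
-/
theorem tendsto_apply_Lam {ι : Type*} {l : Filter ι} {T : ι → BH p →ₗ[ℂ] BK p}
    {T' : BH p →ₗ[ℂ] BK p} (hT : ∀ᶠ t in l, IsContractive (T t))
    (h : ∀ A, Tendsto (fun t => T t A) l (𝓝 (T' A))) {v : ι → BK p} {a : BK p}
    (hv : Tendsto v l (𝓝 a)) : Tendsto (fun t => T t (Lam p (v t))) l (𝓝 (T' (Lam p a))) := by
  have h1 : Tendsto (fun t => T t (Lam p (v t - a))) l (𝓝 0) := by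
    refine squeeze_zero_norm' (hT.mono fun t ht => (ht _).trans (norm_Lam_le _)) ?_
    exact tendsto_iff_norm_sub_tendsto_zero.1 hv
  have h2 := h1.add (h (Lam p a))
  simpa using h2

namespace IsCornerPair

variable {ω : WeightMap p} {L Θ Θ' : BK p →ₗ[ℂ] BK p} {U : Ultrafilter ℝ}

/-- The weight map obtained as the limit of the corners of the boundary representations. -/
theorem exists_weight (h : IsCornerPair ω L Θ Θ') (hω : IsQWeightMap ω)
    (hU : (U : Filter ℝ) ≤ 𝓝[>] 0) :
    ∃ η : WeightMap p, ∀ X : bdryAlg p,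
      Tendsto (fun t => toWeight (Θ ∘ₗ bdryRep ω t) X) U (𝓝 (η X)) := by
  refine exists_pointwise_limit U
    (fun t => toWeight (Θ ∘ₗ bdryRep ω t) ∘ₗ (bdryAlg p).subtype) fun X => ?_
  obtain ⟨B, rfl⟩ := exists_toBdryAlg_eq X
  refine ⟨‖(ω ∘ₗ toBdryAlg p) 1‖ * ‖B‖, ?_⟩
  filter_upwards [hU self_mem_nhdsWithin] with t ht
  exact h.norm_toWeight_sandwich_le hω ht B

theorem exists_rep (h : IsCornerPair ω L Θ Θ') (hω : IsQWeightMap ω)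
    (hU : (U : Filter ℝ) ≤ 𝓝[>] 0) {s : ℝ} (hs : 0 < s) :
    ∃ ψ : BH p →ₗ[ℂ] BK p, ∀ A,
      Tendsto (fun t => stopped (Θ ∘ₗ bdryRep ω t) s A) U (𝓝 (ψ A)) := by
  refine exists_pointwise_limit U (fun t => stopped (Θ ∘ₗ bdryRep ω t) s) fun A => ⟨‖A‖, ?_⟩
  filter_upwards [hU (Ioo_mem_nhdsGT hs)] with t ht
  exact (hω.rep_contractive s hs).of_le ((h.isLocalRep hω ht.1).isCP_stopped s)
    (h.isCP_bdryRep_sub_stopped hω ht.1 ht.2.le) A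

variable {η : WeightMap p}

/-- The identities relating `toWeight` and `stopped` at each t pass to the limit and identify the
limit of the stopped maps as the boundary representation of η. -/
theorem isUnit_and_bdryRep_eq (h : IsCornerPair ω L Θ Θ') (hω : IsQWeightMap ω)
    (hU : (U : Filter ℝ) ≤ 𝓝[>] 0)
    (hη : ∀ X : bdryAlg p, Tendsto (fun t => toWeight (Θ ∘ₗ bdryRep ω t) X) U (𝓝 (η X)))
    {s : ℝ} (hs : 0 < s) {ψ : BH p →ₗ[ℂ] BK p}
    (hψ : ∀ A, Tendsto (fun t => stopped (Θ ∘ₗ bdryRep ω t) s A) U (𝓝 (ψ A))) :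
    IsUnit (iotaAdd η s) ∧ bdryRep η s = ψ := by
  have hpos : ∀ᶠ t in U, (0 : ℝ) < t := hU self_mem_nhdsWithin
  have hcut : ∀ A, Tendsto (fun t => toWeight (Θ ∘ₗ bdryRep ω t) (cutMap p s A)) U
      (𝓝 (cutoff η s A)) := fun A => by
    rw [cutoff_apply hs]
    exact hη ⟨cutMap p s A, cutMap_mem hs A⟩
  have hcontr : ∀ᶠ t in U, IsContractive (stopped (Θ ∘ₗ bdryRep ω t) s) := by
    filter_upwards [hU (Ioo_mem_nhdsGT hs)] with t ht
    exact (hω.rep_contractive s hs).of_le ((h.isLocalRep hω ht.1).isCP_stopped s)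
      (h.isCP_bdryRep_sub_stopped hω ht.1 ht.2.le)
  refine QWeight.isUnit_and_bdryRep_eq (fun A => ?_) fun A => ?_
  · have h1 := tendsto_const_nhds (x := A) |>.add (hcut (Lam p A))
    refine tendsto_nhds_unique (h1.sub (tendsto_apply_Lam hcontr hψ h1)) ?_
    refine tendsto_const_nhds.congr' ?_
    filter_upwards [hpos] with t ht
    exact ((h.isLocalRep hω ht).stopped_resolvent s A).symm
  · refine tendsto_nhds_unique (hψ A) ?_
    refine ((hcut A).sub (tendsto_apply_Lam hcontr hψ (hcut A))).congr' ?_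
    filter_upwards [hpos] with t ht
    exact ((h.isLocalRep hω ht).stopped_eq_sub s A).symm

theorem isQSubordinate (h : IsCornerPair ω L Θ Θ') (hω : IsQWeightMap ω)
    (hU : (U : Filter ℝ) ≤ 𝓝[>] 0)
    (hη : ∀ X : bdryAlg p, Tendsto (fun t => toWeight (Θ ∘ₗ bdryRep ω t) X) U (𝓝 (η X))) :
    IsQSubordinate ω η := by
  have hpos : ∀ᶠ t in U, (0 : ℝ) < t := hU self_mem_nhdsWithin
  have hrep : ∀ s, 0 < s → IsUnit (iotaAdd η s) ∧ IsCP (bdryRep η s) ∧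
      IsCP (bdryRep ω s - bdryRep η s) := fun s hs => by
    obtain ⟨ψ, hψ⟩ := h.exists_rep hω hU hs
    obtain ⟨hu, rfl⟩ := h.isUnit_and_bdryRep_eq hω hU hη hs hψ
    refine ⟨hu, ?_, ?_⟩
    · refine IsCP.of_tendsto hψ ?_
      filter_upwards [hpos] with t ht
      exact (h.isLocalRep hω ht).isCP_stopped s
    · refine IsCP.of_tendsto
        (T := fun t => bdryRep ω s - stopped (Θ ∘ₗ bdryRep ω t) s)
        (fun A => tendsto_const_nhds.sub (hψ A)) ?_
      filter_upwards [hU (Ioo_mem_nhdsGT hs)] with t ht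
      exact h.isCP_bdryRep_sub_stopped hω ht.1 ht.2.le
  have hηcp : IsCPWeightMap η := fun n A hA f => by
    have h1 : Tendsto (fun t => ∑ i, ∑ j,
        ⟪f i, toWeight (Θ ∘ₗ bdryRep ω t) (star (A i) * A j) (f j)⟫_ℂ) U
        (𝓝 (∑ i, ∑ j, ⟪f i, η ⟨star (A i) * A j, hA i j⟩ (f j)⟫_ℂ)) := by
      refine tendsto_finsetSum _ fun i _ => tendsto_finsetSum _ fun j _ => ?_
      refine tendsto_const_nhds.inner ?_
      exact ((ContinuousLinearMap.apply ℂ (K p) (f j)).continuous.tendsto _).comp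
        (hη ⟨star (A i) * A j, hA i j⟩)
    exact ge_of_tendsto h1 (hpos.mono fun t ht => (h.isLocalRep hω ht).isCP_toWeight n A f)
  have hle : IsCP (ω ∘ₗ toBdryAlg p - η ∘ₗ toBdryAlg p) := by
    refine IsCP.of_tendsto (U := (U : Filter ℝ)) (T := fun t => cutoff ω t ∘ₗ sandwich (rootOp p) -
      toWeight (Θ ∘ₗ bdryRep ω t) ∘ₗ sandwich (rootOp p)) (fun B => ?_) ?_
    · exact ((hω.boundaryWeight.tendsto_cutoff B).mono_left hU).sub (hη (toBdryAlg p B))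
    · filter_upwards [hpos] with t ht
      exact (h.isCP_cutoff_sub_toWeight hω ht).comp (isCP_sandwich star_rootOp)
  refine ⟨hω, ⟨?_, hηcp, fun s hs => (hrep s hs).1, fun s hs => (hrep s hs).2.1,
    fun s hs => ?_, fun s hs => ?_⟩, fun s hs => (hrep s hs).2.2⟩
  -- Normality is not preserved by pointwise limits; it comes from domination by the normal maps of
  -- ω.
  · exact IsNormalMap.of_le hω.boundaryWeight hηcp.isCP_comp_toBdryAlg hle
  · exact (hω.rep_contractive s hs).of_le (hrep s hs).2.1 (hrep s hs).2.2
  · exact (hω.rep_normal s hs).of_le (hrep s hs).2.1 (hrep s hs).2.2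

/-- One inclusion passes from the approximating weights to the limit. For the other, an element A of
the range of Θ is recovered as the limit of the boundary representations of η at Λ(A), because the
part of π_sΛ(A) outside the corner tends to Θ'(A) = 0. -/
theorem range_eq (h : IsCornerPair ω L Θ Θ') (hω : IsQWeightMap ω)
    (hL : IsCPIdempotentOnto L (LinearMap.range ω)) (hU : (U : Filter ℝ) ≤ 𝓝[>] 0)
    (hUL : ∀ A, Tendsto (fun t => bdryRep ω t (Lam p A)) U (𝓝 (L A)))
    (hη : ∀ X : bdryAlg p, Tendsto (fun t => toWeight (Θ ∘ₗ bdryRep ω t) X) U (𝓝 (η X))) :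
    LinearMap.range η = LinearMap.range Θ := by
  have hpos : ∀ᶠ t in U, (0 : ℝ) < t := hU self_mem_nhdsWithin
  have hcont : ∀ T : BK p →ₗ[ℂ] BK p, Continuous T := fun T =>
    LinearMap.continuous_of_finiteDimensional T
  apply le_antisymm
  · rintro _ ⟨X, rfl⟩
    refine (Submodule.closed_of_finiteDimensional (LinearMap.range Θ)).mem_of_tendsto (hη X) ?_
    filter_upwards [hpos] with t ht
    exact h.toWeight_mem hω ht _
  · rintro _ ⟨B, rfl⟩
    set A := Θ B
    have hLA : L A = A := hL.apply_of_mem (h.mem B)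
    have h1 : Tendsto (fun s => Θ (bdryRep ω s (Lam p A))) U (𝓝 A) := by
      have := ((hcont Θ).tendsto _).comp (hUL A)
      rwa [hLA, h.idem] at this
    have h2 : Tendsto (fun s => Θ' (bdryRep ω s (Lam p A))) U (𝓝 0) := by
      have := ((hcont Θ').tendsto _).comp (hUL A)
      rwa [hLA, h.kill] at this
    have hb : ∀ s, 0 < s → ‖Θ (bdryRep ω s (Lam p A)) - bdryRep η s (Lam p A)‖ ≤
        ‖Θ' (bdryRep ω s (Lam p A))‖ := fun s hs => by
      obtain ⟨ψ, hψ⟩ := h.exists_rep hω hU hs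
      rw [(h.isUnit_and_bdryRep_eq hω hU hη hs hψ).2]
      refine le_of_tendsto (tendsto_const_nhds.sub (hψ (Lam p A))).norm ?_
      filter_upwards [hU (Ioo_mem_nhdsGT hs)] with t ht
      exact h.norm_sub_stopped_le hω hL ht.1 ht.2.le _
    have h3 : Tendsto (fun s => Θ (bdryRep ω s (Lam p A)) - bdryRep η s (Lam p A)) U (𝓝 0) := by
      refine squeeze_zero_norm' (hpos.mono fun s hs => hb s hs) ?_
      simpa using h2.norm
    have h4 : Tendsto (fun s => bdryRep η s (Lam p A)) U (𝓝 A) := by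
      simpa using h1.sub h3
    refine (Submodule.closed_of_finiteDimensional (LinearMap.range η)).mem_of_tendsto h4 ?_
    filter_upwards [hpos] with s hs
    exact bdryRep_mem_range hs
      ((h.isQSubordinate hω hU hη).right.invertible s hs) _

/-- A corner of a `q`-weight map is realised by a `q`-subordinate. -/
theorem exists_isQSubordinate (h : IsCornerPair ω L Θ Θ') (hω : IsQWeightMap ω)
    (hL : IsCPIdempotentOnto L (LinearMap.range ω)) (hlim : IsLimitPoint ω L) :
    ∃ η, IsQSubordinate ω η ∧ LinearMap.range η = LinearMap.range Θ := by
  obtain ⟨U, hU, hUL⟩ := isLimitPoint_iff.1 hlim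
  obtain ⟨η, hη⟩ := h.exists_weight hω hU
  exact ⟨η, h.isQSubordinate hω hU hη, h.range_eq hω hL hU hUL hη⟩

end IsCornerPair

/-! ### Central projections -/

section Central

variable {L : BK p →ₗ[ℂ] BK p} {𝓛 : Submodule ℂ (BK p)} {Q : BK p}

/-- The Choi–Effros identity needs only the outer factors in the range of L. -/
theorem ceMul_assoc (h : IsCPIdempotentOnto L 𝓛) {A C : BK p} (hA : A ∈ 𝓛) (hC : C ∈ 𝓛)
    (B : BK p) : ceMul L (ceMul L A B) C = ceMul L A (ceMul L B C) := by
  simp only [ceMul]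
  rw [h.apply_apply_mul hC, h.apply_mul_apply hA, mul_assoc]

theorem one_ceMul (h : IsCPIdempotentOnto L 𝓛) {A : BK p} (hA : A ∈ 𝓛) :
    ceMul L (L 1) A = A := by
  rw [ceMul, h.apply_apply_mul hA, one_mul, h.apply_of_mem hA]

theorem ceMul_one (h : IsCPIdempotentOnto L 𝓛) {A : BK p} (hA : A ∈ 𝓛) :
    ceMul L A (L 1) = A := by
  rw [ceMul, h.apply_mul_apply hA, mul_one, h.apply_of_mem hA]

/-- The corner map `A ↦ L(Q A Q)`. -/
def cornerMap (L : BK p →ₗ[ℂ] BK p) (Q : BK p) : BK p →ₗ[ℂ] BK p := L ∘ₗ sandwich Q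

theorem cornerMap_apply (h : IsCPIdempotentOnto L 𝓛) (hQ : IsCentralProjection L 𝓛 Q) (A : BK p) :
    cornerMap L Q A = ceMul L Q (ceMul L A Q) := by
  simp only [ceMul]
  rw [h.apply_mul_apply hQ.mem, ← mul_assoc]
  rfl

theorem cornerMap_of_mem (h : IsCPIdempotentOnto L 𝓛) (hQ : IsCentralProjection L 𝓛 Q) {A : BK p}
    (hA : A ∈ 𝓛) : cornerMap L Q A = ceMul L Q A := by
  rw [cornerMap_apply h hQ, ← hQ.central A hA, ← ceMul_assoc h hQ.mem hA, hQ.idempotent]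

theorem cornerMap_mem (h : IsCPIdempotentOnto L 𝓛) (A : BK p) : cornerMap L Q A ∈ 𝓛 :=
  h.apply_mem _

theorem isCP_cornerMap (h : IsCPIdempotentOnto L 𝓛) (hQ : IsCentralProjection L 𝓛 Q) :
    IsCP (cornerMap L Q) :=
  h.cp.comp (isCP_sandwich hQ.selfAdjoint)

theorem cornerMap_cornerMap (h : IsCPIdempotentOnto L 𝓛) (hQ : IsCentralProjection L 𝓛 Q)
    (A : BK p) : cornerMap L Q (cornerMap L Q A) = cornerMap L Q A := by
  rw [cornerMap_of_mem h hQ (cornerMap_mem h A), cornerMap_apply h hQ,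
    ← ceMul_assoc h hQ.mem (C := ceMul L A Q) (h.apply_mem _), hQ.idempotent]

theorem cornerMap_one (hQ : IsCentralProjection L 𝓛 Q) :
    cornerMap L Q 1 = Q := by
  have : cornerMap L Q 1 = ceMul L Q Q := by simp [cornerMap, sandwich, ceMul]
  rw [this, hQ.idempotent]

theorem IsCentralProjection.compl (h : IsCPIdempotentOnto L 𝓛) (hQ : IsCentralProjection L 𝓛 Q) :
    IsCentralProjection L 𝓛 (L 1 - Q) := by
  have hsub : ∀ A B, ceMul L A (B - Q) = ceMul L A B - ceMul L A Q := fun A B => by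
    simp [ceMul, mul_sub]
  have hsub' : ∀ A B, ceMul L (B - Q) A = ceMul L B A - ceMul L Q A := fun A B => by
    simp [ceMul, sub_mul]
  have h1 := h.apply_mem 1
  refine ⟨sub_mem h1 hQ.mem, ?_, ?_, fun A hA => ?_⟩
  · rw [clm_star_sub, ← h.cp.map_star, star_one, hQ.selfAdjoint]
  · rw [hsub, hsub', hsub', one_ceMul h h1, one_ceMul h hQ.mem, ceMul_one h hQ.mem, hQ.idempotent]
    simp
  · rw [hsub, hsub', one_ceMul h hA, ceMul_one h hA, hQ.central A hA]

theorem ceMul_compl (h : IsCPIdempotentOnto L 𝓛) {A : BK p}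
    (hA : A ∈ 𝓛) : ceMul L (L 1 - Q) A = A - ceMul L Q A := by
  have : ceMul L (L 1 - Q) A = ceMul L (L 1) A - ceMul L Q A := by simp [ceMul, sub_mul]
  rw [this, one_ceMul h hA]

theorem IsCentralProjection.isCornerPair {ω : WeightMap p}
    (h : IsCPIdempotentOnto L (LinearMap.range ω))
    (hQ : IsCentralProjection L (LinearMap.range ω) Q) :
    IsCornerPair ω L (cornerMap L Q) (cornerMap L (L 1 - Q)) where
  cp := isCP_cornerMap h hQ
  cp' := isCP_cornerMap h (hQ.compl h)
  mem A := cornerMap_mem h A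
  add A hA := by
    rw [cornerMap_of_mem h hQ hA, cornerMap_of_mem h (hQ.compl h) hA, ceMul_compl h hA]
    simp
  idem := cornerMap_cornerMap h hQ
  idem' := cornerMap_cornerMap h (hQ.compl h)
  kill A := by
    have hm := cornerMap_mem (Q := Q) h A
    rw [cornerMap_of_mem h (hQ.compl h) hm, ceMul_compl h hm, ← cornerMap_of_mem h hQ hm,
      cornerMap_cornerMap h hQ, sub_self]
  one := by
    rw [cornerMap_one hQ, cornerMap_one (hQ.compl h)]
    simp

theorem coe_range_cornerMap (h : IsCPIdempotentOnto L 𝓛) (hQ : IsCentralProjection L 𝓛 Q) :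
    (LinearMap.range (cornerMap L Q) : Set (BK p)) = ceIdeal L 𝓛 Q := by
  ext B
  constructor
  · rintro ⟨A, rfl⟩
    exact ⟨ceMul L A Q, h.apply_mem _, (cornerMap_apply h hQ A).symm⟩
  · rintro ⟨A, hA, rfl⟩
    exact ⟨A, cornerMap_of_mem h hQ hA⟩

theorem exists_isQSubordinate_of_isCentralProjection {ω : WeightMap p} (hω : IsQWeightMap ω)
    (h0 : IsIndexZero ω) (hL : IsLimitPoint ω L)
    (hQ : IsCentralProjection L (LinearMap.range ω) Q) :
    ∃ η, IsQSubordinate ω η ∧ LinearMap.range η = LinearMap.range (cornerMap L Q) :=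
  (hQ.isCornerPair (hω.isCPIdempotentOnto h0 hL)).exists_isQSubordinate hω
    (hω.isCPIdempotentOnto h0 hL) hL

/-- Subordinates with complementary ranges are incomparable unless one of them vanishes. -/
theorem IsCornerPair.eq_zero_of_isQSubordinate {ω η₁ η₂ : WeightMap p}
    {Θ Θ' : BK p →ₗ[ℂ] BK p} (h : IsCornerPair ω L Θ Θ')
    (h₁ : LinearMap.range η₁ = LinearMap.range Θ) (h₂ : LinearMap.range η₂ = LinearMap.range Θ')
    (hle : IsQSubordinate η₁ η₂) : η₂ = 0 := by
  refine hle.right.boundaryWeight.eq_zero fun t ht A => ?_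
  have hm₁ := bdryRep_mem_range ht (hle.left.invertible t ht) 1
  have hm₂ := bdryRep_mem_range ht (hle.right.invertible t ht) 1
  rw [h₁] at hm₁
  rw [h₂] at hm₂
  obtain ⟨B₁, hB₁⟩ := hm₁
  obtain ⟨B₂, hB₂⟩ := hm₂
  -- Θ' annihilates the range of η₁ and fixes that of η₂, so applying it to the positive difference
  -- leaves minus the value of the η₂ representation at I. That value is also positive, hence zero.
  have h3 := h.cp'.map_nonneg ((hle.le t ht).map_nonneg zero_le_one)
  rw [LinearMap.sub_apply, ← hB₁, ← hB₂, map_sub, h.kill, h.idem', hB₂, zero_sub,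
    neg_nonneg] at h3
  have h4 := (hle.right.rep_cp t ht).map_nonneg zero_le_one
  have h5 : bdryRep η₂ t 1 = 0 := le_antisymm h3 h4
  have h6 : ∀ B, bdryRep η₂ t B = 0 := fun B => by
    have := (hle.right.rep_cp t ht).norm_le B
    rwa [h5, norm_zero, zero_mul, norm_le_zero_iff] at this
  have h7 := bdryRep_add_cutoff (hle.right.invertible t ht) A
  rw [h6, map_zero, map_zero, add_zero] at h7
  exact h7.symm

/-- The range of a `q`-pure map of index zero has no nontrivial central projections. -/
theorem IsQPure.eq_zero_or_eq_one {ω : WeightMap p} (hpure : IsQPure ω) (h0 : IsIndexZero ω)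
    (hL : IsLimitPoint ω L) (hQ : IsCentralProjection L (LinearMap.range ω) Q) :
    Q = 0 ∨ Q = L 1 := by
  have hω := hpure.isQWeightMap
  have hi := hω.isCPIdempotentOnto h0 hL
  have hQ' := hQ.compl hi
  obtain ⟨η₁, hs₁, hr₁⟩ := exists_isQSubordinate_of_isCentralProjection hω h0 hL hQ
  obtain ⟨η₂, hs₂, hr₂⟩ := exists_isQSubordinate_of_isCentralProjection hω h0 hL hQ'
  have hzero : ∀ {R : BK p} {η : WeightMap p}, IsCentralProjection L (LinearMap.range ω) R →
      LinearMap.range η = LinearMap.range (cornerMap L R) → η = 0 → R = 0 := by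
    intro R η hR hr hη
    have : R ∈ LinearMap.range (cornerMap L R) := ⟨1, cornerMap_one hR⟩
    rw [← hr, hη, LinearMap.range_zero] at this
    exact this
  rcases hpure.total η₁ η₂ hs₁ hs₂ with hle | hle
  · right
    have := hzero hQ' hr₂ ((hQ.isCornerPair hi).eq_zero_of_isQSubordinate hr₁ hr₂ hle)
    exact (sub_eq_zero.1 this).symm
  · left
    refine hzero hQ hr₁ ((hQ'.isCornerPair hi).eq_zero_of_isQSubordinate hr₂ ?_ hle)
    rw [sub_sub_cancel]
    exact hr₁

end Central
end QWeight
end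

noncomputable section
namespace QWeight

/-! ### Finite-dimensional `*`-algebras with trivial centre -/

section StarAlgebra

variable {𝓐 : Type*} [Ring 𝓐] [StarRing 𝓐]

/-- For self-adjoint b the power b^(2^(k+1)) is c*c with c = b^(2^k), so properness halves the
exponent repeatedly. -/
theorem eq_zero_of_isSelfAdjoint_of_isNilpotent (hp : ∀ a : 𝓐, star a * a = 0 → a = 0) {b : 𝓐}
    (hb : star b = b) (hn : IsNilpotent b) : b = 0 := by
  obtain ⟨n, hn⟩ := hn
  have h2 : ∀ k, b ^ (2 ^ k) = 0 → b = 0 := fun k => by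
    induction k with
    | zero => simp
    | succ k ih =>
      intro h
      refine ih (hp _ ?_)
      rw [star_pow, hb, ← pow_add, ← two_mul, ← pow_succ']
      exact h
  exact h2 n (pow_eq_zero_of_le n.lt_two_pow_self.le hn)

/-- The Jacobson radical of an Artinian ring is nilpotent. For a in it, a*a is self-adjoint and
nilpotent, hence zero. -/
theorem isSemisimpleRing_of_proper [IsArtinianRing 𝓐] (hp : ∀ a : 𝓐, star a * a = 0 → a = 0) :
    IsSemisimpleRing 𝓐 := by
  rw [IsArtinianRing.isSemisimpleRing_iff_jacobson, eq_bot_iff]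
  intro a ha
  obtain ⟨n, hn⟩ := IsSemiprimaryRing.isNilpotent (R := 𝓐)
  have h1 : star a * a ∈ Ring.jacobson 𝓐 := Ideal.mul_mem_left _ _ ha
  have h2 : IsNilpotent (star a * a) := ⟨n, by
    have := Ideal.pow_mem_pow h1 n
    rw [hn] at this
    simpa using this⟩
  exact hp a (eq_zero_of_isSelfAdjoint_of_isNilpotent hp (by simp) h2)

/-- Wedderburn's theorem yields central idempotents that know nothing of the involution; properness
makes them projections. -/
theorem star_eq_of_central_of_idempotent (hp : ∀ a : 𝓐, star a * a = 0 → a = 0) {z : 𝓐}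
    (hz : z * z = z) (hc : ∀ a, z * a = a * z) : star z = z := by
  have hz' : star z * star z = star z := by rw [← star_mul, hz]
  have h1 : z - star z * z = 0 := by
    refine hp _ ?_
    have e : star z * z * (star z * z) = star z * z := by
      rw [mul_assoc, ← mul_assoc z, hc (star z), mul_assoc, hz, ← mul_assoc, hz']
    rw [star_sub, star_mul, star_star, sub_mul, mul_sub, mul_sub, e, ← mul_assoc (star z), hz',
      mul_assoc, hz]
    simp
  have h2 : z = star z * z := sub_eq_zero.1 h1
  rw [h2, star_mul, star_star]

variable [Algebra ℂ 𝓐] [FiniteDimensional ℂ 𝓐] [Nontrivial 𝓐]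

theorem exists_algEquiv_matrix_of_trivial_center (hp : ∀ a : 𝓐, star a * a = 0 → a = 0)
    (hc : ∀ z : 𝓐, star z = z → z * z = z → (∀ a, z * a = a * z) → z = 0 ∨ z = 1) :
    ∃ q : ℕ, 0 < q ∧ Nonempty (𝓐 ≃ₐ[ℂ] Matrix (Fin q) (Fin q) ℂ) := by
  have := IsArtinianRing.of_finite ℂ 𝓐
  have := isSemisimpleRing_of_proper hp
  obtain ⟨n, d, hd, ⟨e⟩⟩ := IsSemisimpleRing.exists_algEquiv_pi_matrix_of_isAlgClosed ℂ 𝓐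
  rcases n.eq_zero_or_pos with rfl | hn
  · exact absurd (e.injective (Subsingleton.elim (e 0) (e 1))) zero_ne_one
  let i₀ : Fin n := ⟨0, hn⟩
  -- The unit of one Wedderburn block is a nonzero central idempotent, so it is 1 and there are no
  -- other blocks.
  let w : Π i, Matrix (Fin (d i)) (Fin (d i)) ℂ := Pi.single i₀ 1
  have hw : w ≠ 0 := fun h => one_ne_zero (α := Matrix (Fin (d i₀)) (Fin (d i₀)) ℂ) (by
    simpa [w] using congrFun h i₀)
  have hww : w * w = w := by simp [w, ← Pi.single_mul]
  have hwc : ∀ a, w * a = a * w := fun a => by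
    ext1 i
    by_cases hi : i = i₀
    · subst hi; simp [w]
    · simp [w, Pi.single_eq_of_ne hi]
  have hz : e.symm w * e.symm w = e.symm w := by rw [← map_mul, hww]
  have hzc : ∀ a, e.symm w * a = a * e.symm w := fun a => by
    obtain ⟨b, rfl⟩ := e.symm.surjective a
    rw [← map_mul, hwc, map_mul]
  have hw1 : w = 1 := by
    rcases hc _ (star_eq_of_central_of_idempotent hp hz hzc) hz hzc with h | h
    · exact absurd ((map_eq_zero_iff _ e.symm.injective).1 h) hw
    · exact (map_eq_one_iff _ e.symm.injective).1 h
  have hall : ∀ i, i = i₀ := fun i => by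
    by_contra hi
    have := congrFun hw1 i
    simp [w, Pi.single_eq_of_ne hi] at this
  refine ⟨d i₀, Nat.pos_of_ne_zero (hd i₀).out, ⟨AlgEquiv.ofBijective
    ((Pi.evalAlgHom ℂ (fun i => Matrix (Fin (d i)) (Fin (d i)) ℂ) i₀).comp e.toAlgHom) ⟨?_, ?_⟩⟩⟩
  · refine (injective_iff_map_eq_zero _).2 fun a ha => ?_
    refine (map_eq_zero_iff _ e.injective).1 (funext fun i => ?_)
    rw [hall i]
    exact ha
  · intro M
    refine ⟨e.symm (Pi.single i₀ M), ?_⟩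
    change e (e.symm (Pi.single i₀ M)) i₀ = M
    simp

open scoped MatrixOrder Matrix.Norms.L2Operator in
theorem exists_conjTranspose_mul_self_of_posDef {q : ℕ} {G : Matrix (Fin q) (Fin q) ℂ}
    (hG : G.PosDef) : ∃ S : Matrix (Fin q) (Fin q) ℂ, IsUnit S.det ∧ G = S.conjTranspose * S := by
  obtain ⟨S, hS⟩ := CStarAlgebra.nonneg_iff_eq_star_mul_self.1 hG.posSemidef.nonneg
  refine ⟨S, ?_, hS⟩
  have h1 := (Matrix.isUnit_iff_isUnit_det _).1 hG.isUnit
  rw [hS, Matrix.det_mul] at h1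
  exact isUnit_of_mul_isUnit_right h1

/-- A finite-dimensional `*`-algebra with a faithful positive functional and without nontrivial
central projections is a full matrix algebra. -/
theorem exists_star_matrix_equiv [StarModule ℂ 𝓐] (τ : 𝓐 →ₗ[ℂ] ℂ)
    (hτ : ∀ a, a ≠ 0 → 0 < τ (star a * a)) (hτs : ∀ a, τ (star a) = star (τ a))
    (hc : ∀ z : 𝓐, star z = z → z * z = z → (∀ a, z * a = a * z) → z = 0 ∨ z = 1) :
    ∃ (q : ℕ) (Φ : Matrix (Fin q) (Fin q) ℂ ≃ₐ[ℂ] 𝓐), 0 < q ∧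
      ∀ M, Φ M.conjTranspose = star (Φ M) := by
  have hp : ∀ a : 𝓐, star a * a = 0 → a = 0 := fun a ha => by
    by_contra h
    have := hτ a h
    simp [ha] at this
  obtain ⟨q, hq, ⟨e⟩⟩ := exists_algEquiv_matrix_of_trivial_center hp hc
  let j₀ : Fin q := ⟨0, hq⟩
  -- These span a minimal left ideal, on which a acts by the matrix e(a). With the inner product
  -- τ(a*b) their Gram matrix is G.
  let u : Fin q → 𝓐 := fun i => e.symm (Matrix.single i j₀ 1)
  have hu : ∀ a j, a * u j = ∑ k, e a k j • u k := fun a j => by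
    apply e.injective
    simp only [u, map_mul, map_sum, map_smul, AlgEquiv.apply_symm_apply]
    ext x y
    by_cases hy : y = j₀
    · subst hy
      simp [Matrix.sum_apply, Matrix.single_apply]
    · rw [Matrix.mul_single_apply_of_ne _ _ _ _ _ hy]
      simp [Matrix.sum_apply, Ne.symm hy]
  let G : Matrix (Fin q) (Fin q) ℂ := Matrix.of fun i j => τ (star (u i) * u j)
  have hG : G.PosDef := by
    refine Matrix.PosDef.of_dotProduct_mulVec_pos ?_ fun {x} hx => ?_
    · ext i j
      simp [G, ← hτs]
    · have h1 : star x ⬝ᵥ G.mulVec x =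
          τ (star (∑ i, x i • u i) * ∑ i, x i • u i) := by
        rw [star_sum, Finset.sum_mul_sum]
        simp only [star_smul, smul_mul_smul_comm, map_sum, map_smul, smul_eq_mul, dotProduct,
          Matrix.mulVec, Pi.star_apply, G, Matrix.of_apply, Finset.mul_sum]
        refine Finset.sum_congr rfl fun i _ => Finset.sum_congr rfl fun j _ => ?_
        ring
      rw [h1]
      refine hτ _ fun h => hx (funext fun i => ?_)
      have h2 := congrArg e h
      simp only [u, map_sum, map_smul, AlgEquiv.apply_symm_apply, map_zero] at h2
      have h3 := congrFun (congrFun h2 i) j₀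
      simpa [Matrix.sum_apply, Matrix.single_apply] using h3
  -- Left multiplication by a* is the adjoint of left multiplication by a for this inner product.
  have hinv : ∀ a, G * e (star a) = (e a).conjTranspose * G := fun a => by
    ext i j
    have h1 : (G * e (star a)) i j = τ (star (u i) * (star a * u j)) := by
      rw [hu, Finset.mul_sum, map_sum, Matrix.mul_apply]
      refine Finset.sum_congr rfl fun k _ => ?_
      rw [mul_smul_comm, map_smul, smul_eq_mul, mul_comm]
      rfl
    have h2 : ((e a).conjTranspose * G) i j = τ (star (a * u i) * u j) := by
      rw [hu a i, star_sum, Finset.sum_mul, map_sum, Matrix.mul_apply]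
      refine Finset.sum_congr rfl fun k _ => ?_
      rw [star_smul, smul_mul_assoc, map_smul]
      rfl
    rw [h1, h2, star_mul, mul_assoc]
  obtain ⟨S, hS, hGS⟩ := exists_conjTranspose_mul_self_of_posDef hG
  have hSS : S * S⁻¹ = 1 := Matrix.mul_nonsing_inv _ hS
  have hSS' : S⁻¹ * S = 1 := Matrix.nonsing_inv_mul _ hS
  -- Since G = S*S, conjugation by S passes to an orthonormal basis, in which the adjoint for G
  -- becomes the conjugate transpose.
  let c : Matrix (Fin q) (Fin q) ℂ ≃ₐ[ℂ] Matrix (Fin q) (Fin q) ℂ := AlgEquiv.ofAlgHom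
    (AlgHom.ofLinearMap
      { toFun := fun M => S⁻¹ * M * S
        map_add' := fun M N => by rw [mul_add, add_mul]
        map_smul' := fun r M => by simp }
      (by simp [hSS']) fun M N => by
        simp only [LinearMap.coe_mk, AddHom.coe_mk, mul_assoc]
        rw [← mul_assoc S S⁻¹, hSS, one_mul])
    (AlgHom.ofLinearMap
      { toFun := fun M => S * M * S⁻¹
        map_add' := fun M N => by rw [mul_add, add_mul]
        map_smul' := fun r M => by simp }
      (by simp [hSS]) fun M N => by
        simp only [LinearMap.coe_mk, AddHom.coe_mk, mul_assoc]
        rw [← mul_assoc S⁻¹ S, hSS', one_mul])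
    (by
      ext1 M
      change S⁻¹ * (S * M * S⁻¹) * S = M
      simp only [mul_assoc, hSS', mul_one]
      rw [← mul_assoc, hSS', one_mul])
    (by
      ext1 M
      change S * (S⁻¹ * M * S) * S⁻¹ = M
      simp only [mul_assoc, hSS, mul_one]
      rw [← mul_assoc, hSS, one_mul])
  have hcM : ∀ M, c M = S⁻¹ * M * S := fun M => rfl
  refine ⟨q, c.trans e.symm, hq, fun M => ?_⟩
  apply e.injective
  have h1 := hinv (e.symm (c M))
  have h2 : S.conjTranspose * (S * e (star (e.symm (c M)))) =
      S.conjTranspose * (M.conjTranspose * S) := by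
    rw [← mul_assoc, ← hGS, h1, AlgEquiv.apply_symm_apply, hcM, hGS]
    simp only [Matrix.conjTranspose_mul, mul_assoc]
    rw [← mul_assoc (S⁻¹).conjTranspose, ← Matrix.conjTranspose_mul, hSS,
      Matrix.conjTranspose_one, one_mul]
  have h3 : S * e (star (e.symm (c M))) = M.conjTranspose * S := by
    have h4 : (S⁻¹).conjTranspose * S.conjTranspose = 1 := by
      rw [← Matrix.conjTranspose_mul, hSS, Matrix.conjTranspose_one]
    have := congrArg ((S⁻¹).conjTranspose * ·) h2
    simpa only [← mul_assoc, h4, one_mul] using this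
  change e (e.symm (c M.conjTranspose)) = e (star (e.symm (c M)))
  rw [AlgEquiv.apply_symm_apply, hcM, mul_assoc, ← h3, ← mul_assoc, hSS', one_mul]

end StarAlgebra

/-! ### The Choi–Effros algebra as a `*`-algebra -/

variable {p : ℕ} {L : BK p →ₗ[ℂ] BK p} {𝓛 : Submodule ℂ (BK p)}

/-- The range of a completely positive contractive idempotent, as a type carrying the
Choi–Effros product. -/
def CEAlg (_h : IsCPIdempotentOnto L 𝓛) : Type := 𝓛

namespace CEAlg

variable {h : IsCPIdempotentOnto L 𝓛}

instance : AddCommGroup (CEAlg h) := inferInstanceAs (AddCommGroup 𝓛)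

instance : Module ℂ (CEAlg h) := inferInstanceAs (Module ℂ 𝓛)

instance : FiniteDimensional ℂ (CEAlg h) := inferInstanceAs (FiniteDimensional ℂ 𝓛)

/-- The inclusion of the Choi–Effros algebra. -/
def incl (h : IsCPIdempotentOnto L 𝓛) : CEAlg h →ₗ[ℂ] BK p := 𝓛.subtype

theorem incl_injective : Function.Injective (incl h) := Subtype.val_injective

theorem incl_mem (a : CEAlg h) : incl h a ∈ 𝓛 := a.2

theorem range_incl : LinearMap.range (incl h) = 𝓛 := 𝓛.range_subtype

instance : Mul (CEAlg h) := ⟨fun a b => ⟨ceMul L a.1 b.1, h.apply_mem _⟩⟩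

instance : One (CEAlg h) := ⟨⟨L 1, h.apply_mem _⟩⟩

instance : Star (CEAlg h) := ⟨fun a => ⟨star a.1, h.star_mem a.2⟩⟩

theorem incl_mul (a b : CEAlg h) : incl h (a * b) = ceMul L (incl h a) (incl h b) := rfl

theorem incl_one : incl h 1 = L 1 := rfl

theorem incl_star (a : CEAlg h) : incl h (star a) = star (incl h a) := rfl

instance : Ring (CEAlg h) :=
  { (inferInstance : AddCommGroup (CEAlg h)) with
    left_distrib := fun a b c => incl_injective (by
      simp only [incl_mul, map_add, ceMul, mul_add])
    right_distrib := fun a b c => incl_injective (by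
      simp only [incl_mul, map_add, ceMul, add_mul])
    zero_mul := fun a => incl_injective (by simp [incl_mul, ceMul])
    mul_zero := fun a => incl_injective (by simp [incl_mul, ceMul])
    mul_assoc := fun a b c => incl_injective (ceMul_assoc h a.2 c.2 b.1)
    one_mul := fun a => incl_injective (one_ceMul h a.2)
    mul_one := fun a => incl_injective (ceMul_one h a.2) }

instance : Algebra ℂ (CEAlg h) :=
  Algebra.ofModule
    (fun r a b => incl_injective (by simp only [incl_mul, map_smul, ceMul, smul_mul_assoc]))
    (fun r a b => incl_injective (by simp only [incl_mul, map_smul, ceMul, mul_smul_comm]))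

instance : StarRing (CEAlg h) where
  star_involutive a := incl_injective (star_star (incl h a))
  star_mul a b := incl_injective (by
    rw [incl_star, incl_mul, incl_mul, incl_star, incl_star, ceMul, ceMul, ← h.cp.map_star,
      star_mul])
  star_add a b := incl_injective (clm_star_add (incl h a) (incl h b))

instance : StarModule ℂ (CEAlg h) where
  star_smul c a := incl_injective (clm_star_smul c (incl h a))

/-- The trace of `B(K)`, restricted to the Choi–Effros algebra. -/
def trace (h : IsCPIdempotentOnto L 𝓛) : CEAlg h →ₗ[ℂ] ℂ :=
  (∑ i, matrixCoeff (EuclideanSpace.basisFun (Fin p) ℂ i) (EuclideanSpace.basisFun (Fin p) ℂ i)) ∘ₗ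
    incl h

theorem trace_apply (a : CEAlg h) : trace h a = ∑ i,
    ⟪EuclideanSpace.basisFun (Fin p) ℂ i, incl h a (EuclideanSpace.basisFun (Fin p) ℂ i)⟫_ℂ := by
  simp [trace, matrixCoeff]

theorem trace_star (a : CEAlg h) : trace h (star a) = star (trace h a) := by
  rw [trace_apply, trace_apply, star_sum]
  refine Finset.sum_congr rfl fun i _ => ?_
  rw [incl_star, inner_apply_star, ← inner_conj_symm]
  rfl

/-- For a in the range of L, Kadison–Schwarz gives L(a*a) ≥ a*a in B(K), so faithfulness of the
ordinary trace carries over to the product ⋆. -/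
theorem trace_star_mul_self_pos (a : CEAlg h) (ha : a ≠ 0) : 0 < trace h (star a * a) := by
  set b := EuclideanSpace.basisFun (Fin p) ℂ
  have h1 : ∀ i, ((‖incl h a (b i)‖ ^ 2 : ℝ) : ℂ) ≤ ⟪b i, incl h (star a * a) (b i)⟫_ℂ := fun i => by
    have h2 := h.cp.star_mul_self_le h.contractive (incl h a)
    rw [h.apply_of_mem (incl_mem a)] at h2
    have h3 := inner_nonneg_of_nonneg (sub_nonneg.2 h2) (b i)
    rw [_root_.sub_apply, inner_sub_right, sub_nonneg] at h3
    refine le_trans (le_of_eq ?_) h3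
    change _ = ⟪b i, star (incl h a) (incl h a (b i))⟫_ℂ
    rw [inner_apply_star, inner_self_eq_norm_sq_to_K]
    push_cast
    rfl
  have h2 : ((∑ i, ‖incl h a (b i)‖ ^ 2 : ℝ) : ℂ) ≤ trace h (star a * a) := by
    rw [trace_apply]
    push_cast
    refine Finset.sum_le_sum fun i _ => ?_
    have := h1 i
    push_cast at this
    exact this
  refine lt_of_lt_of_le ?_ h2
  rw [← Complex.ofReal_zero, Complex.real_lt_real]
  by_contra! hle
  have h3 : ∀ i, incl h a (b i) = 0 := fun i => by
    have := (Finset.sum_eq_zero_iff_of_nonneg fun i _ => by positivity).1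
      (le_antisymm hle (Finset.sum_nonneg fun i _ => by positivity)) i (Finset.mem_univ i)
    simpa using this
  have h4 : (incl h a : K p →ₗ[ℂ] K p) = 0 := b.toBasis.ext fun i => by simpa using h3 i
  refine ha (incl_injective ?_)
  rw [map_zero]
  ext1 x
  exact LinearMap.congr_fun h4 x

theorem isCentralProjection_incl {z : CEAlg h} (hs : star z = z) (hz : z * z = z)
    (hc : ∀ a, z * a = a * z) : IsCentralProjection L 𝓛 (incl h z) where
  mem := z.2
  selfAdjoint := congrArg (incl h) hs
  idempotent := congrArg (incl h) hz
  central A hA := congrArg (incl h) (hc ⟨A, hA⟩)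

end CEAlg

theorem IsCPIdempotentOnto.isChoiEffrosFactorFor (h : IsCPIdempotentOnto L 𝓛) (hne : 𝓛 ≠ ⊥)
    (hc : ∀ Q, IsCentralProjection L 𝓛 Q → Q = 0 ∨ Q = L 1) : IsChoiEffrosFactorFor L 𝓛 := by
  have : Nontrivial (CEAlg h) := Submodule.nontrivial_iff_ne_bot.2 hne
  obtain ⟨q, Φ, hq, hΦ⟩ := exists_star_matrix_equiv (CEAlg.trace h) CEAlg.trace_star_mul_self_pos
    CEAlg.trace_star fun z hs hz hz' => by
      rcases hc _ (CEAlg.isCentralProjection_incl hs hz hz') with h0 | h1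
      · exact Or.inl (CEAlg.incl_injective (by rw [h0, map_zero]))
      · exact Or.inr (CEAlg.incl_injective (by rw [h1, CEAlg.incl_one]))
  refine ⟨h, q, CEAlg.incl h ∘ₗ Φ.toLinearMap, hq, ?_, ?_, ?_, fun A => ?_, fun A B => ?_⟩
  · exact CEAlg.incl_injective.comp Φ.injective
  · rw [LinearMap.range_comp_of_range_eq_top _ (LinearMap.range_eq_top.2 Φ.surjective),
      CEAlg.range_incl]
  · change CEAlg.incl h (Φ 1) = _
    rw [map_one, CEAlg.incl_one]
  · exact congrArg (CEAlg.incl h) (hΦ A)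
  · change CEAlg.incl h (Φ (A * B)) = _
    rw [map_mul, CEAlg.incl_mul]
    rfl

end QWeight
end

theorem theorem5p7 (p : ℕ) (ω : WeightMap p) (hω : IsQWeightMap ω) (h0 : IsIndexZero ω) :
    -- limit points exist, and each of them makes the range of `ω` a Choi–Effros algebra
    (∃ L, IsLimitPoint ω L) ∧
    (∀ L, IsLimitPoint ω L → IsCPIdempotentOnto L (LinearMap.range ω)) ∧
    -- every nonzero central projection is realised by a `q`-subordinate
    (∀ L, IsLimitPoint ω L → ∀ Q, IsCentralProjection L (LinearMap.range ω) Q → Q ≠ 0 →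
      ∃ η, IsQSubordinate ω η ∧
        (LinearMap.range η : Set (BK p)) = ceIdeal L (LinearMap.range ω) Q) ∧
    -- the range of a nonzero `q`-pure map is a Choi–Effros factor
    (IsQPure ω → ω ≠ 0 →
      IsChoiEffrosFactor (LinearMap.range ω) ∧
        ∀ L, IsLimitPoint ω L → IsChoiEffrosFactorFor L (LinearMap.range ω)) := by
  have hi : ∀ L, IsLimitPoint ω L → IsCPIdempotentOnto L (LinearMap.range ω) := fun L hL =>
    hω.isCPIdempotentOnto h0 hL
  have hfactor : IsQPure ω → ω ≠ 0 → ∀ L, IsLimitPoint ω L →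
      IsChoiEffrosFactorFor L (LinearMap.range ω) := fun hp hne L hL =>
    (hi L hL).isChoiEffrosFactorFor (fun hb => hne (LinearMap.range_eq_bot.1 hb))
      fun Q hQ => hp.eq_zero_or_eq_one h0 hL hQ
  obtain ⟨L₀, hL₀⟩ := hω.exists_isLimitPoint
  refine ⟨⟨L₀, hL₀⟩, hi, fun L hL Q hQ _ => ?_, fun hp hne =>
    ⟨⟨L₀, hfactor hp hne L₀ hL₀⟩, hfactor hp hne⟩⟩
  obtain ⟨η, hη, hr⟩ := exists_isQSubordinate_of_isCentralProjection hω h0 hL hQ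
  exact ⟨η, hη, by rw [hr, coe_range_cornerMap (hi L hL) hQ]⟩
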